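/- Let $M$ be a connected and simply connected smooth (finite-dimensional) manifold and let $\omega$ be a 2-plectic form on $M$, i.e. a smooth 3-form that is closed ($d\omega=0$) and nondegenerate ($v\in T_xM$, $\iota_v\omega=0$ imply $v=0$). Call a 1-form $\alpha$ Hamiltonian if $d\alpha=-\iota_{v_\alpha}\omega$ for some (necessarily unique) vector field $v_\alpha$, called a Hamiltonian vector field; let $\Omega^1_{\mathrm{Ham}}(M)$ be the space of Hamiltonian 1-forms and $\mathfrak X_{\mathrm{Ham}}(M)$ the Lie algebra of Hamiltonian vector fields. A Lie 2-algebra is a 2-term complex of real vector spaces $L_1\xrightarrow{d}L_0$ with a skew-symmetric chain map $[\cdot,\cdot]:L\otimes L\to L$ and a skew-symmetric chain homotopy $J:L^{\otimes 3}\to L$ (the Jacobiator) from $[x,[y,z]]$ to $[[x,y],z]+[y,[x,z]]$ such that $$[x,J(y,z,w)]+J(x,[y,z],w)+J(x,z,[y,w])+[J(x,y,z),w]+[z,J(x,y,w)]$$ $$=J(x,y,[z,w])+J([x,y],z,w)+[y,J(x,z,w)]+J(y,[x,z],w)+J(y,z,[x,w]).$$ A morphism $L\to L'$ is a chain map $\phi$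 together with a skew-symmetric chain homotopy $\Phi:L\otimes L\to L'$ from $\phi([x,y])$ to $[\phi(x),\phi(y)]'$ such that $$\phi_1(J(x,y,z))-J'(\phi_0x,\phi_0y,\phi_0z)=\Phi(x,[y,z])-\Phi([x,y],z)-\Phi(y,[x,z])-[\Phi(x,y),\phi_0z]'+[\phi_0x,\Phi(y,z)]'-[\phi_0y,\Phi(x,z)]';$$ it is a quasi-isomorphism if $\phi$ induces isomorphisms on homology. (Here a chain homotopy $H$ from $F$ to $G$ satisfies $F-G=dH+Hd$.) A Lie 2-algebra $L'$ is a strict central extension of $L''$ by $L$ if there are morphisms $L\xrightarrow{\phi}L'\xrightarrow{\phi'}L''$ whose underlying chain maps form a short exact sequence of complexes and $[\operatorname{im}\phi,L']'=0$. Consider the following Lie 2-algebras. - $L_\infty(M,\omega)$: the complex $C^\infty(M)\xrightarrow{d}\Omega^1_{\mathrm{Ham}}(M)$ with bracket $[\alpha,\beta]=\iota_{v_\beta}\iota_{v_\alpha}\omega$ in degree $0$ and zero otherwise, and Jacobiator $J(\alpha,\beta,\gamma)=\iota_{v_\alpha}\iota_{v_\beta}\iota_{v_\gamma}\omega$. -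 For $x\in M$, $L_\infty(\mathfrak X_{\mathrm{Ham}}(M),x)$: the complex $\mathbb R\xrightarrow{0}\mathfrak X_{\mathrm{Ham}}(M)$ with the Lie bracket of vector fields in degree $0$ and zero otherwise, and Jacobiator $J_x(v_1,v_2,v_3)=\iota_{v_1}\iota_{v_2}\iota_{v_3}\omega|_x$. - The trivial Lie 2-algebra $0\to\mathfrak X_{\mathrm{Ham}}(M)$ given by the Lie algebra $\mathfrak X_{\mathrm{Ham}}(M)$, and the abelian Lie 2-algebra $b\mathfrak u(1)=(\mathbb R\to 0)$. Then for every $x\in M$ there is a quasi-isomorphism of Lie 2-algebras $L_\infty(M,\omega)\to L_\infty(\mathfrak X_{\mathrm{Ham}}(M),x)$, and $L_\infty(\mathfrak X_{\mathrm{Ham}}(M),x)$ is a strict central extension of the trivial Lie 2-algebra $\mathfrak X_{\mathrm{Ham}}(M)$ by $b\mathfrak u(1)$. In particular, $L_\infty(M,\omega)$ is quasi-isomorphic to a strict central extension of $\mathfrak X_{\mathrm{Ham}}(M)$ by $b\mathfrak u(1)$. -/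

import Mathlib

set_option linter.unusedSectionVars false
open Set Filter Topology Manifold ContDiff VectorField

noncomputable section
namespace Plectic

section Forms

variable {E : Type*} [NormedAddCommGroup E] [NormedSpace ℝ E]
  {M : Type*} [TopologicalSpace M] [ChartedSpace E M]

/-- Not necessarily smooth `k`-forms on `M`: families of alternating forms on the tangent spaces. -/
abbrev RawForm (E : Type*) [NormedAddCommGroup E] [NormedSpace ℝ E]
    (M : Type*) [TopologicalSpace M] [ChartedSpace E M] (k : ℕ) : Type _ :=
  ∀ x : M, TangentSpace 𝓘(ℝ, E) x [⋀^Fin k]→L[ℝ] ℝ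

/-- The derivative at `x` of the chart around `c`. (Every `TangentSpace 𝓘(ℝ, E) x` is by definition
a copy of `E`, so this map is typed as an endomorphism of `E`.) -/
def dChart (c x : M) : E →L[ℝ] E := mfderiv 𝓘(ℝ, E) 𝓘(ℝ, E) (extChartAt 𝓘(ℝ, E) c) x

/-- The derivative at `u` of the inverse of the chart around `c`. -/
def dSymm (c : M) (u : E) : E →L[ℝ] E := mfderiv 𝓘(ℝ, E) 𝓘(ℝ, E) (extChartAt 𝓘(ℝ, E) c).symm u

/-- The local representative of a form in the chart around `c`: its pullback along the inverse of
the chart (meaningful on the target of the chart). -/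
def chartRep {k : ℕ} (α : RawForm E M k) (c : M) (u : E) : E [⋀^Fin k]→L[ℝ] ℝ :=
  ContinuousAlternatingMap.compContinuousLinearMap (M' := E)
    (α ((extChartAt 𝓘(ℝ, E) c).symm u)) (dSymm c u)

/-- The exterior derivative: at `x`, compute it in the chart around `x` and pull back. -/
def extD {k : ℕ} (α : RawForm E M k) : RawForm E M (k + 1) := fun x =>
  ContinuousAlternatingMap.compContinuousLinearMap (M := E) (M' := E)
    (extDeriv (chartRep α x) (extChartAt 𝓘(ℝ, E) x x)) (dChart x x)

/-- The interior product `ι_v α = α(v, ·, …, ·)`. -/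
def contract {k : ℕ} (v : ∀ x : M, TangentSpace 𝓘(ℝ, E) x) (α : RawForm E M (k + 1)) :
    RawForm E M k := fun x =>
  ContinuousAlternatingMap.curryLeft (E := E) (α x) (v x)

/-- The vector space `Ω^k(M)` of smooth `k`-forms: the local representatives are smooth. -/
def DiffForm (E : Type*) [NormedAddCommGroup E] [NormedSpace ℝ E]
    (M : Type*) [TopologicalSpace M] [ChartedSpace E M] (k : ℕ) : Submodule ℝ (RawForm E M k) where
  carrier := {α | ∀ c : M, ContDiffOn ℝ ∞ (chartRep α c) (extChartAt 𝓘(ℝ, E) c).target}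
  add_mem' h h' c := (h c).add (h' c)
  zero_mem' _ := contDiffOn_const (c := (0 : E [⋀^Fin k]→L[ℝ] ℝ))
  smul_mem' r _ h c := (h c).const_smul r

/-- The differential of a function as a 1-form. -/
def rawDiff (f : M → ℝ) : RawForm E M 1 := fun x =>
  ContinuousAlternatingMap.ofSubsingleton ℝ (TangentSpace 𝓘(ℝ, E) x) ℝ 0
    (mfderiv 𝓘(ℝ, E) 𝓘(ℝ, ℝ) f x)

end Forms

section Local
variable {E : Type*} [NormedAddCommGroup E] [NormedSpace ℝ E]

theorem extDeriv_one {B : E → E [⋀^Fin 1]→L[ℝ] ℝ} {u : E} (p q : E) :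
    extDeriv B u ![p, q] = fderiv ℝ B u p ![q] - fderiv ℝ B u q ![p] := by
  have h0 : (0 : Fin 2).removeNth ![p, q] = ![q] := by ext i; fin_cases i; rfl
  have h1 : (1 : Fin 2).removeNth ![p, q] = ![p] := by ext i; fin_cases i; rfl
  simp [extDeriv, ContinuousAlternatingMap.alternatizeUncurryFin_apply, Fin.sum_univ_succ, h0, h1]
  ring

theorem extDeriv_two {B : E → E [⋀^Fin 2]→L[ℝ] ℝ} {u : E} (p q r : E) :
    extDeriv B u ![p, q, r] =
      fderiv ℝ B u p ![q, r] - fderiv ℝ B u q ![p, r] + fderiv ℝ B u r ![p, q] := by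
  have h0 : (0 : Fin 3).removeNth ![p, q, r] = ![q, r] := by ext i; fin_cases i <;> rfl
  have h1 : (1 : Fin 3).removeNth ![p, q, r] = ![p, r] := by ext i; fin_cases i <;> rfl
  have h2 : (2 : Fin 3).removeNth ![p, q, r] = ![p, q] := by ext i; fin_cases i <;> rfl
  simp [extDeriv, ContinuousAlternatingMap.alternatizeUncurryFin_apply, Fin.sum_univ_succ,
    h0, h1, h2]
  ring

theorem extDeriv_three {B : E → E [⋀^Fin 3]→L[ℝ] ℝ} {u : E} (p q r s : E) :
    extDeriv B u ![p, q, r, s] =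
      fderiv ℝ B u p ![q, r, s] - fderiv ℝ B u q ![p, r, s] + fderiv ℝ B u r ![p, q, s]
        - fderiv ℝ B u s ![p, q, r] := by
  have h0 : (0 : Fin 4).removeNth ![p, q, r, s] = ![q, r, s] := by ext i; fin_cases i <;> rfl
  have h1 : (1 : Fin 4).removeNth ![p, q, r, s] = ![p, r, s] := by ext i; fin_cases i <;> rfl
  have h2 : (2 : Fin 4).removeNth ![p, q, r, s] = ![p, q, s] := by ext i; fin_cases i <;> rfl
  have h3 : (3 : Fin 4).removeNth ![p, q, r, s] = ![p, q, r] := by ext i; fin_cases i <;> rfl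
  simp [extDeriv, ContinuousAlternatingMap.alternatizeUncurryFin_apply, Fin.sum_univ_succ,
    h0, h1, h2, h3]
  ring

theorem hasFDerivAt_curry {k : ℕ} {B : E → E [⋀^Fin (k + 1)]→L[ℝ] ℝ} {a : E → E} {u : E}
    (hB : DifferentiableAt ℝ B u) (ha : DifferentiableAt ℝ a u) :
    DifferentiableAt ℝ (fun y => (B y).curryLeft (a y)) u ∧
    ∀ p, fderiv ℝ (fun y => (B y).curryLeft (a y)) u p =
      (fderiv ℝ B u p).curryLeft (a u) + (B u).curryLeft (fderiv ℝ a u p) := by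
  have h1 : HasFDerivAt (fun y => (B y).curryLeft)
      ((ContinuousAlternatingMap.curryLeftLI (𝕜 := ℝ) (E := E) (F := ℝ)
        (n := k)).toContinuousLinearMap.comp (fderiv ℝ B u)) u :=
    HasFDerivAt.comp (g := ⇑(ContinuousAlternatingMap.curryLeftLI (𝕜 := ℝ) (E := E) (F := ℝ)
        (n := k)).toContinuousLinearMap) u
      (ContinuousLinearMap.hasFDerivAt _) hB.hasFDerivAt
  have := h1.clm_apply ha.hasFDerivAt
  refine ⟨this.differentiableAt, fun p => ?_⟩
  rw [this.fderiv]
  simp [add_comm]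

theorem alt2 (B : E [⋀^Fin 2]→L[ℝ] ℝ) (p q : E) : B ![p, q] = - B ![q, p] := by
  have := B.toAlternatingMap.map_swap ![q, p] (i := 0) (j := 1) (by decide)
  rw [← show ![q, p] ∘ (Equiv.swap (0 : Fin 2) 1) = ![p, q] by ext i; fin_cases i <;> rfl]
  exact this

theorem alt3_01 (B : E [⋀^Fin 3]→L[ℝ] ℝ) (p q r : E) : B ![p, q, r] = - B ![q, p, r] := by
  have := B.toAlternatingMap.map_swap ![q, p, r] (i := 0) (j := 1) (by decide)
  rw [← show ![q, p, r] ∘ (Equiv.swap (0 : Fin 3) 1) = ![p, q, r] by ext i; fin_cases i <;> rfl]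
  exact this

theorem alt3_12 (B : E [⋀^Fin 3]→L[ℝ] ℝ) (p q r : E) : B ![p, q, r] = - B ![p, r, q] := by
  have := B.toAlternatingMap.map_swap ![p, r, q] (i := 1) (j := 2) (by decide)
  rw [← show ![p, r, q] ∘ (Equiv.swap (1 : Fin 3) 2) = ![p, q, r] by ext i; fin_cases i <;> rfl]
  exact this

theorem add3_1 (B : E [⋀^Fin 3]→L[ℝ] ℝ) (p p' q r : E) :
    B ![p + p', q, r] = B ![p, q, r] + B ![p', q, r] :=
  congrArg (fun f => f ![q, r]) (map_add B.curryLeft p p')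

theorem add3_2 (B : E [⋀^Fin 3]→L[ℝ] ℝ) (p q q' r : E) :
    B ![p, q + q', r] = B ![p, q, r] + B ![p, q', r] := by
  rw [alt3_01, add3_1, alt3_01, alt3_01 B q']; ring

theorem add3_3 (B : E [⋀^Fin 3]→L[ℝ] ℝ) (p q r r' : E) :
    B ![p, q, r + r'] = B ![p, q, r] + B ![p, q, r'] := by
  rw [alt3_12, add3_2, alt3_12, alt3_12 B p r']; ring

theorem smul3_1 (B : E [⋀^Fin 3]→L[ℝ] ℝ) (c : ℝ) (p q r : E) :
    B ![c • p, q, r] = c * B ![p, q, r] :=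
  congrArg (fun f => f ![q, r]) (map_smul B.curryLeft c p)

theorem smul3_2 (B : E [⋀^Fin 3]→L[ℝ] ℝ) (c : ℝ) (p q r : E) :
    B ![p, c • q, r] = c * B ![p, q, r] := by
  rw [alt3_01, smul3_1, alt3_01]; ring

theorem smul3_3 (B : E [⋀^Fin 3]→L[ℝ] ℝ) (c : ℝ) (p q r : E) :
    B ![p, q, c • r] = c * B ![p, q, r] := by
  rw [alt3_12, smul3_2, alt3_12]; ring

/-- If `B` is closed and `ι_a B` is closed at `u`, the Lie derivative of `B` along `a` vanishes
at `u`. -/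
theorem lie_deriv_zero {B : E → E [⋀^Fin 3]→L[ℝ] ℝ} {a : E → E} {u : E}
    (hB : DifferentiableAt ℝ B u) (ha : DifferentiableAt ℝ a u)
    (h0 : extDeriv B u = 0) (h1 : extDeriv (fun y => (B y).curryLeft (a y)) u = 0) (p q r : E) :
    fderiv ℝ B u (a u) ![p, q, r] + B u ![fderiv ℝ a u p, q, r] + B u ![p, fderiv ℝ a u q, r]
      + B u ![p, q, fderiv ℝ a u r] = 0 := by
  have e0 := extDeriv_three (B := B) (u := u) (a u) p q r
  have e1 := extDeriv_two (B := fun y => (B y).curryLeft (a y)) (u := u) p q r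
  simp only [h0, h1, (hasFDerivAt_curry hB ha).2] at e0 e1
  simp at e0 e1
  have s1 := alt3_01 (B u) p (fderiv ℝ a u q) r
  have s2 := alt3_12 (B u) p q (fderiv ℝ a u r)
  have s3 := alt3_01 (B u) p (fderiv ℝ a u r) q
  linarith

/-- `d ι_b ι_a B = - ι_[a,b] B` when `B`, `ι_a B` and `ι_b B` are closed. -/
theorem extDeriv_curry_curry {B : E → E [⋀^Fin 3]→L[ℝ] ℝ} {a b : E → E} {u : E}
    (hB : DifferentiableAt ℝ B u) (ha : DifferentiableAt ℝ a u) (hb : DifferentiableAt ℝ b u)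
    (h0 : extDeriv B u = 0) (h1 : extDeriv (fun y => (B y).curryLeft (a y)) u = 0)
    (h2 : extDeriv (fun y => (B y).curryLeft (b y)) u = 0) :
    extDeriv (fun y => ((B y).curryLeft (a y)).curryLeft (b y)) u =
      - (B u).curryLeft (lieBracket ℝ a b u) := by
  ext v
  obtain ⟨p, q, rfl⟩ : ∃ p q, v = ![p, q] := ⟨v 0, v 1, by ext i; fin_cases i <;> rfl⟩
  have A := hasFDerivAt_curry hB ha
  rw [extDeriv_one]
  simp only [(hasFDerivAt_curry A.1 hb).2, A.2]
  have k1 := lie_deriv_zero hB ha h0 h1 (b u) p q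
  have e2 := extDeriv_two (B := fun y => (B y).curryLeft (a y)) (u := u) (b u) p q
  simp only [h1, A.2] at e2
  have k2 := lie_deriv_zero hB hb h0 h2 (a u) p q
  simp [lieBracket] at *
  have s1 := alt3_12 (B u) (a u) p (fderiv ℝ b u q)
  linarith


/-- `d (B(a,b,c))` in terms of brackets, when `B`, `ι_a B`, `ι_b B`, `ι_c B` are closed. -/
theorem fderiv_contract {B : E → E [⋀^Fin 3]→L[ℝ] ℝ} {a b c : E → E} {u : E}
    (hB : DifferentiableAt ℝ B u) (ha : DifferentiableAt ℝ a u) (hb : DifferentiableAt ℝ b u)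
    (hc : DifferentiableAt ℝ c u)
    (h0 : extDeriv B u = 0) (h1 : extDeriv (fun y => (B y).curryLeft (a y)) u = 0)
    (h2 : extDeriv (fun y => (B y).curryLeft (b y)) u = 0)
    (h3 : extDeriv (fun y => (B y).curryLeft (c y)) u = 0) (p : E) :
    fderiv ℝ (fun y => B y ![c y, b y, a y]) u p =
      B u ![a u, lieBracket ℝ b c u, p] - (B u ![lieBracket ℝ a b u, c u, p]
        + B u ![b u, lieBracket ℝ a c u, p]) := by
  have A := hasFDerivAt_curry hB hc
  have A' := hasFDerivAt_curry A.1 hb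
  have A'' := hasFDerivAt_curry A'.1 ha
  have e : (fun y => B y ![c y, b y, a y]) =
      fun y => ((((B y).curryLeft (c y)).curryLeft (b y)).curryLeft (a y)) ![] := rfl
  have e' : fderiv ℝ (fun y => B y ![c y, b y, a y]) u p =
      fderiv ℝ (fun y => ((((B y).curryLeft (c y)).curryLeft (b y)).curryLeft (a y))) u p ![] := by
    rw [e]
    have := (A''.1.hasFDerivAt.continuousAlternatingMap_apply_const ![]).fderiv
    rw [this]; rfl
  rw [e', A''.2, A'.2, A.2]
  have m1 : ∀ x y z w, B u ![x - y, z, w] = B u ![x, z, w] - B u ![y, z, w] := fun x y z w =>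
    congrArg (fun f => f ![z, w]) (map_sub (B u).curryLeft x y)
  have m2 : ∀ x y z w, B u ![z, x - y, w] = B u ![z, x, w] - B u ![z, y, w] := fun x y z w => by
    rw [alt3_01, m1, alt3_01, alt3_01 (B u) y]; ring
  have k1 := lie_deriv_zero hB ha h0 h1 (b u) (c u) p
  have k2 := lie_deriv_zero hB hb h0 h2 (a u) (c u) p
  have k3 := lie_deriv_zero hB hc h0 h3 (a u) (b u) p
  have e0 := extDeriv_three (B := B) (u := u) (a u) (b u) (c u) p
  simp only [h0] at e0
  simp [lieBracket, m1, m2] at *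
  have n0 := alt3_01 (fderiv ℝ B u p)
  have n1 := alt3_12 (fderiv ℝ B u p)
  have r1 : fderiv ℝ B u p ![c u, b u, a u] = - fderiv ℝ B u p ![a u, b u, c u] := by
    rw [n0, n1, n0]; ring
  have P : ∀ x y z, B u ![x, z, y] = - B u ![x, y, z] ∧ B u ![y, x, z] = - B u ![x, y, z] ∧
      B u ![y, z, x] = B u ![x, y, z] ∧ B u ![z, x, y] = B u ![x, y, z] ∧
      B u ![z, y, x] = - B u ![x, y, z] := fun x y z => by
    have i1 := alt3_12 (B u) x z y
    have i2 := alt3_01 (B u) y x z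
    have i3 := alt3_12 (B u) y z x
    have i4 := alt3_01 (B u) z x y
    have i5 := alt3_01 (B u) z y x
    refine ⟨?_, ?_, ?_, ?_, ?_⟩ <;> linarith
  have q1 := P (fderiv ℝ a u (b u)) (c u) p
  have q2 := P (fderiv ℝ a u (c u)) (b u) p
  have q3 := P (fderiv ℝ a u p) (b u) (c u)
  have q4 := P (fderiv ℝ b u (a u)) (c u) p
  have q5 := P (fderiv ℝ b u (c u)) (a u) p
  have q6 := P (fderiv ℝ b u p) (a u) (c u)
  have q7 := P (fderiv ℝ c u (a u)) (b u) p
  have q8 := P (fderiv ℝ c u (b u)) (a u) p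
  have q9 := P (fderiv ℝ c u p) (a u) (b u)
  linarith


/-- Vanishing of the Chevalley–Eilenberg differential of `(a, b, c) ↦ B(c, b, a)` at a point. -/
theorem cocycle_local {B : E → E [⋀^Fin 3]→L[ℝ] ℝ} {a b c e : E → E} {u : E}
    (hB : DifferentiableAt ℝ B u) (ha : DifferentiableAt ℝ a u) (hb : DifferentiableAt ℝ b u)
    (hc : DifferentiableAt ℝ c u) (he : DifferentiableAt ℝ e u)
    (h0 : extDeriv B u = 0) (h1 : extDeriv (fun y => (B y).curryLeft (a y)) u = 0)
    (h2 : extDeriv (fun y => (B y).curryLeft (b y)) u = 0)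
    (h3 : extDeriv (fun y => (B y).curryLeft (c y)) u = 0)
    (h4 : extDeriv (fun y => (B y).curryLeft (e y)) u = 0) :
    B u ![e u, lieBracket ℝ b c u, a u] + B u ![lieBracket ℝ b e u, c u, a u] =
      B u ![lieBracket ℝ c e u, b u, a u] + B u ![e u, c u, lieBracket ℝ a b u]
        + B u ![e u, lieBracket ℝ a c u, b u] + B u ![lieBracket ℝ a e u, c u, b u] := by
  have A := hasFDerivAt_curry hB hc
  have A' := hasFDerivAt_curry A.1 hb
  have A'' := hasFDerivAt_curry A'.1 ha
  have f1 := fderiv_contract hB ha hb hc h0 h1 h2 h3 (e u)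
  have e' : fderiv ℝ (fun y => B y ![c y, b y, a y]) u (e u) =
      fderiv ℝ (fun y => ((((B y).curryLeft (c y)).curryLeft (b y)).curryLeft (a y))) u
        (e u) ![] := by
    have := (A''.1.hasFDerivAt.continuousAlternatingMap_apply_const ![]).fderiv
    exact congrArg (fun f => f (e u)) this
  rw [e', A''.2, A'.2, A.2] at f1
  have m1 : ∀ x y z w, B u ![x - y, z, w] = B u ![x, z, w] - B u ![y, z, w] := fun x y z w =>
    congrArg (fun f => f ![z, w]) (map_sub (B u).curryLeft x y)
  have m2 : ∀ x y z w, B u ![z, x - y, w] = B u ![z, x, w] - B u ![z, y, w] := fun x y z w => by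
    rw [alt3_01, m1, alt3_01, alt3_01 (B u) y]; ring
  have m3 : ∀ x y z w, B u ![z, w, x - y] = B u ![z, w, x] - B u ![z, w, y] := fun x y z w => by
    rw [alt3_12, m2, alt3_12, alt3_12 (B u) z y]; ring
  have k1 := lie_deriv_zero hB he h0 h4 (c u) (b u) (a u)
  simp [lieBracket, m1, m2, m3] at *
  have P : ∀ x y z, B u ![x, z, y] = - B u ![x, y, z] ∧ B u ![y, x, z] = - B u ![x, y, z] ∧
      B u ![y, z, x] = B u ![x, y, z] ∧ B u ![z, x, y] = B u ![x, y, z] ∧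
      B u ![z, y, x] = - B u ![x, y, z] := fun x y z => by
    have i1 := alt3_12 (B u) x z y
    have i2 := alt3_01 (B u) y x z
    have i3 := alt3_12 (B u) y z x
    have i4 := alt3_01 (B u) z x y
    have i5 := alt3_01 (B u) z y x
    refine ⟨?_, ?_, ?_, ?_, ?_⟩ <;> linarith
  have q1 := P (fderiv ℝ a u (b u)) (c u) (e u)
  have q2 := P (fderiv ℝ a u (c u)) (b u) (e u)
  have q3 := P (fderiv ℝ a u (e u)) (b u) (c u)
  have q4 := P (fderiv ℝ b u (a u)) (c u) (e u)
  have q5 := P (fderiv ℝ b u (c u)) (a u) (e u)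
  have q6 := P (fderiv ℝ b u (e u)) (a u) (c u)
  have q7 := P (fderiv ℝ c u (a u)) (b u) (e u)
  have q8 := P (fderiv ℝ c u (b u)) (a u) (e u)
  have q9 := P (fderiv ℝ c u (e u)) (a u) (b u)
  have p1 := P (fderiv ℝ e u (a u)) (b u) (c u)
  have p2 := P (fderiv ℝ e u (b u)) (a u) (c u)
  have p3 := P (fderiv ℝ e u (c u)) (a u) (b u)
  linarith

end Local

section Charts
variable {E : Type*} [NormedAddCommGroup E] [NormedSpace ℝ E]
  {M : Type*} [TopologicalSpace M] [ChartedSpace E M]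

theorem isOpen_target (c : M) : IsOpen (extChartAt 𝓘(ℝ, E) c).target :=
  isOpen_extChartAt_target c

variable [IsManifold 𝓘(ℝ, E) ∞ M]

theorem symm_contMDiffAt {c : M} {u : E} (hu : u ∈ (extChartAt 𝓘(ℝ, E) c).target) :
    ContMDiffAt 𝓘(ℝ, E) 𝓘(ℝ, E) ∞ (extChartAt 𝓘(ℝ, E) c).symm u :=
  (contMDiffOn_extChartAt_symm c).contMDiffAt ((isOpen_target c).mem_nhds hu)

theorem chart_contMDiffAt {c x : M} (hx : x ∈ (extChartAt 𝓘(ℝ, E) c).source) :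
    ContMDiffAt 𝓘(ℝ, E) 𝓘(ℝ, E) ∞ (extChartAt 𝓘(ℝ, E) c) x :=
  contMDiffAt_extChartAt' (by simpa using hx)

theorem dSymm_comp_dChart {c x : M} (hx : x ∈ (extChartAt 𝓘(ℝ, E) c).source) :
    (dSymm c (extChartAt 𝓘(ℝ, E) c x)).comp (dChart c x) = ContinuousLinearMap.id ℝ E := by
  have := mfderivWithin_extChartAt_symm_comp_mfderiv_extChartAt' (I := 𝓘(ℝ, E)) hx
  simp only [modelWithCornersSelf_coe, range_id, mfderivWithin_univ] at this
  exact this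

theorem dChart_comp_dSymm {c : M} {u : E} (hu : u ∈ (extChartAt 𝓘(ℝ, E) c).target) :
    (dChart c ((extChartAt 𝓘(ℝ, E) c).symm u)).comp (dSymm c u) = ContinuousLinearMap.id ℝ E := by
  have := mfderiv_extChartAt_comp_mfderivWithin_extChartAt_symm (I := 𝓘(ℝ, E)) hu
  simp only [modelWithCornersSelf_coe, range_id, mfderivWithin_univ] at this
  exact this

theorem isInvertible_symm {c : M} {u : E} (hu : u ∈ (extChartAt 𝓘(ℝ, E) c).target) :
    (mfderiv 𝓘(ℝ, E) 𝓘(ℝ, E) (extChartAt 𝓘(ℝ, E) c).symm u).IsInvertible := by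
  have := isInvertible_mfderivWithin_extChartAt_symm (I := 𝓘(ℝ, E)) hu
  simpa only [modelWithCornersSelf_coe, range_id, mfderivWithin_univ] using this

/-- A form is recovered from its local representatives. -/
theorem eq_chartRep_comp {k : ℕ} (α : RawForm E M k) {c x : M}
    (hx : x ∈ (extChartAt 𝓘(ℝ, E) c).source) :
    α x = ContinuousAlternatingMap.compContinuousLinearMap (M := E) (M' := E)
      (chartRep α c (extChartAt 𝓘(ℝ, E) c x)) (dChart c x) := by
  have key : ∀ p : M, p = x → ∀ A : E →L[ℝ] E, A = ContinuousLinearMap.id ℝ E →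
      α x = (show TangentSpace 𝓘(ℝ, E) x [⋀^Fin k]→L[ℝ] ℝ from
        ContinuousAlternatingMap.compContinuousLinearMap (M := E) (M' := E) (α p) A) := by
    rintro p rfl A rfl; rfl
  exact key _ ((extChartAt 𝓘(ℝ, E) c).left_inv hx) _ (dSymm_comp_dChart hx)

theorem form_ext {k : ℕ} {α β : RawForm E M k}
    (h : ∀ x : M, chartRep α x (extChartAt 𝓘(ℝ, E) x x) = chartRep β x (extChartAt 𝓘(ℝ, E) x x)) :
    α = β := by
  funext x
  rw [eq_chartRep_comp α (mem_extChartAt_source x), eq_chartRep_comp β (mem_extChartAt_source x), h]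

theorem fderiv_change {c y : M} {u : E} (hu : u ∈ (extChartAt 𝓘(ℝ, E) c).target)
    (hy : (extChartAt 𝓘(ℝ, E) c).symm u ∈ (extChartAt 𝓘(ℝ, E) y).source) :
    fderiv ℝ (extChartAt 𝓘(ℝ, E) y ∘ (extChartAt 𝓘(ℝ, E) c).symm) u =
      (dChart y ((extChartAt 𝓘(ℝ, E) c).symm u)).comp (dSymm c u) := by
  rw [← mfderiv_eq_fderiv]
  exact mfderiv_comp u ((chart_contMDiffAt hy).mdifferentiableAt (by simp))
    ((symm_contMDiffAt hu).mdifferentiableAt (by simp))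

/-- Local representatives in two charts differ by pullback along the change of charts. -/
theorem chartRep_change {k : ℕ} (α : RawForm E M k) {c y : M} {u : E}
    (hu : u ∈ (extChartAt 𝓘(ℝ, E) c).target)
    (hy : (extChartAt 𝓘(ℝ, E) c).symm u ∈ (extChartAt 𝓘(ℝ, E) y).source) :
    chartRep α c u =
      (chartRep α y ((extChartAt 𝓘(ℝ, E) y ∘ (extChartAt 𝓘(ℝ, E) c).symm) u)
        ).compContinuousLinearMap
        (fderiv ℝ (extChartAt 𝓘(ℝ, E) y ∘ (extChartAt 𝓘(ℝ, E) c).symm) u) := by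
  rw [fderiv_change hu hy, chartRep, eq_chartRep_comp α hy]
  rfl

theorem change_contDiffAt {c y : M} {u : E}
    (hu : u ∈ (extChartAt 𝓘(ℝ, E) c).target)
    (hy : (extChartAt 𝓘(ℝ, E) c).symm u ∈ (extChartAt 𝓘(ℝ, E) y).source) :
    ContDiffAt ℝ ∞ (extChartAt 𝓘(ℝ, E) y ∘ (extChartAt 𝓘(ℝ, E) c).symm) u :=
  ((chart_contMDiffAt hy).comp u (symm_contMDiffAt hu)).contDiffAt

theorem chartRep_contDiffAt {k : ℕ} {α : RawForm E M k} (hα : α ∈ DiffForm E M k) {c : M} {u : E}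
    (hu : u ∈ (extChartAt 𝓘(ℝ, E) c).target) : ContDiffAt ℝ ∞ (chartRep α c) u :=
  (hα c).contDiffAt ((isOpen_target c).mem_nhds hu)

/-- In every chart, `extD` is the exterior derivative of the local representative. -/
theorem chartRep_extD {k : ℕ} {α : RawForm E M k} (hα : α ∈ DiffForm E M k) {c : M} {u : E}
    (hu : u ∈ (extChartAt 𝓘(ℝ, E) c).target) :
    chartRep (extD α) c u = extDeriv (chartRep α c) u := by
  have hys := mem_extChartAt_source (I := 𝓘(ℝ, E)) ((extChartAt 𝓘(ℝ, E) c).symm u)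
  have hyt := mem_extChartAt_target (I := 𝓘(ℝ, E)) ((extChartAt 𝓘(ℝ, E) c).symm u)
  generalize hy : (extChartAt 𝓘(ℝ, E) c).symm u = y at hys hyt
  have ev : chartRep α c =ᶠ[𝓝 u] fun z =>
      (chartRep α y ((extChartAt 𝓘(ℝ, E) y ∘ (extChartAt 𝓘(ℝ, E) c).symm) z)
        ).compContinuousLinearMap
        (fderiv ℝ (extChartAt 𝓘(ℝ, E) y ∘ (extChartAt 𝓘(ℝ, E) c).symm) z) := by
    have h1 := (symm_contMDiffAt hu).continuousAt.preimage_mem_nhds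
      ((isOpen_extChartAt_source (I := 𝓘(ℝ, E)) y).mem_nhds (hy ▸ hys))
    filter_upwards [(isOpen_target c).mem_nhds hu, h1] with z hz hz'
    exact chartRep_change α hz hz'
  have hd : DifferentiableAt ℝ (chartRep α y)
      ((extChartAt 𝓘(ℝ, E) y ∘ (extChartAt 𝓘(ℝ, E) c).symm) u) :=
    (chartRep_contDiffAt hα (by rw [Function.comp_apply, hy]; exact hyt)
      ).differentiableAt (by simp)
  rw [ev.extDeriv_eq, extDeriv_pullback hd (change_contDiffAt hu (hy ▸ hys))
    (by simpa using ENat.LEInfty.out),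
    fderiv_change hu (hy ▸ hys)]
  subst hy
  rfl

/-- The local representative of a vector field. -/
def vecRep (v : ∀ x : M, TangentSpace 𝓘(ℝ, E) x) (c : M) (u : E) : E :=
  mpullback 𝓘(ℝ, E) 𝓘(ℝ, E) (extChartAt 𝓘(ℝ, E) c).symm v u

theorem dSymm_vecRep (v : ∀ x : M, TangentSpace 𝓘(ℝ, E) x) {c : M} {u : E}
    (hu : u ∈ (extChartAt 𝓘(ℝ, E) c).target) :
    dSymm c u (vecRep v c u) = v ((extChartAt 𝓘(ℝ, E) c).symm u) := by
  obtain ⟨e, he⟩ := isInvertible_symm hu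
  change mfderiv 𝓘(ℝ, E) 𝓘(ℝ, E) (extChartAt 𝓘(ℝ, E) c).symm u
    (mpullback 𝓘(ℝ, E) 𝓘(ℝ, E) (extChartAt 𝓘(ℝ, E) c).symm v u) = _
  rw [mpullback_apply, ← he, ContinuousLinearMap.inverse_equiv]
  exact e.apply_symm_apply _

theorem chartRep_contract {k : ℕ} (v : ∀ x : M, TangentSpace 𝓘(ℝ, E) x) (α : RawForm E M (k + 1))
    {c : M} {u : E} (hu : u ∈ (extChartAt 𝓘(ℝ, E) c).target) :
    chartRep (contract v α) c u = (chartRep α c u).curryLeft (vecRep v c u) := by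
  have := ContinuousAlternatingMap.curryLeft_compContinuousLinearMap (E := E) (F := E)
    (α ((extChartAt 𝓘(ℝ, E) c).symm u)) (dSymm c u) (vecRep v c u)
  rw [dSymm_vecRep v hu] at this
  exact this.symm

variable [CompleteSpace E]

theorem vecRep_contDiffAt {v : ∀ x : M, TangentSpace 𝓘(ℝ, E) x}
    (hv : CMDiff ∞ (T% v)) {c : M} {u : E} (hu : u ∈ (extChartAt 𝓘(ℝ, E) c).target) :
    ContDiffAt ℝ ∞ (vecRep v c) u := by
  have := ContMDiffAt.mpullback_vectorField_preimage (m := ∞) (n := ∞) (hv _)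
    (symm_contMDiffAt hu) (isInvertible_symm hu) (by simp)
  exact contMDiffAt_vectorSpace_iff_contDiffAt.mp this

theorem isManifold_min (k : ℕ) : IsManifold 𝓘(ℝ, E) (minSmoothness ℝ k) M := by
  simp only [minSmoothness_of_isRCLikeNormedField]; infer_instance

theorem vecRep_mlieBracket {v w : ∀ x : M, TangentSpace 𝓘(ℝ, E) x}
    (hv : CMDiff ∞ (T% v)) (hw : CMDiff ∞ (T% w)) {c : M} {u : E}
    (hu : u ∈ (extChartAt 𝓘(ℝ, E) c).target) :
    vecRep (mlieBracket 𝓘(ℝ, E) v w) c u = lieBracket ℝ (vecRep v c) (vecRep w c) u := by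
  have : IsManifold 𝓘(ℝ, E) (minSmoothness ℝ 2) M := isManifold_min 2
  have h := mpullback_mlieBracket (n := 2) (x₀ := u) ((hv _).mdifferentiableAt (by simp))
    ((hw _).mdifferentiableAt (by simp)) ((symm_contMDiffAt hu).of_le ENat.LEInfty.out)
    (by simp)
  rw [← mlieBracketWithin_univ (I := 𝓘(ℝ, E)) (M := E), mlieBracketWithin_eq_lieBracketWithin] at h
  exact h.trans (congrFun (lieBracketWithin_univ (V := vecRep v c) (W := vecRep w c)) u)
end Charts

section Calculus
variable {E : Type*} [NormedAddCommGroup E] [NormedSpace ℝ E]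
  {M : Type*} [TopologicalSpace M] [ChartedSpace E M]

/-- Smooth real-valued functions on `M`. -/
abbrev SmoothFun (E : Type*) [NormedAddCommGroup E] [NormedSpace ℝ E]
    (M : Type*) [TopologicalSpace M] [ChartedSpace E M] : Type _ :=
  ContMDiffMap 𝓘(ℝ, E) 𝓘(ℝ, ℝ) M ℝ ∞

/-- Smooth vector fields on `M`. -/
abbrev VField (E : Type*) [NormedAddCommGroup E] [NormedSpace ℝ E]
    (M : Type*) [TopologicalSpace M] [ChartedSpace E M] [IsManifold 𝓘(ℝ, E) ∞ M] : Type _ :=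
  ContMDiffSection 𝓘(ℝ, E) E ∞ (TangentSpace 𝓘(ℝ, E) : M → Type _)

variable [IsManifold 𝓘(ℝ, E) ∞ M]

theorem extD_add {k : ℕ} {α β : RawForm E M k} (hα : α ∈ DiffForm E M k)
    (hβ : β ∈ DiffForm E M k) : extD (α + β) = extD α + extD β := by
  refine form_ext fun x => ?_
  have hx := mem_extChartAt_target (I := 𝓘(ℝ, E)) x
  have h1 := chartRep_extD (add_mem hα hβ) hx
  have h2 : chartRep (extD α + extD β) x (extChartAt 𝓘(ℝ, E) x x) =
    chartRep (extD α) x (extChartAt 𝓘(ℝ, E) x x) + chartRep (extD β) x (extChartAt 𝓘(ℝ, E) x x) :=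
    rfl
  rw [h1, h2, chartRep_extD hα hx, chartRep_extD hβ hx]
  exact extDeriv_add ((chartRep_contDiffAt hα hx).differentiableAt (by simp))
    ((chartRep_contDiffAt hβ hx).differentiableAt (by simp))

theorem extD_smul {k : ℕ} (r : ℝ) (α : RawForm E M k) : extD (r • α) = r • extD α := by
  funext x
  have : chartRep (r • α) x = r • chartRep α x := rfl
  rw [extD, this, extDeriv_smul]
  rfl

theorem contract_mem [CompleteSpace E] {k : ℕ} {α : RawForm E M (k + 1)}
    (hα : α ∈ DiffForm E M (k + 1)) (v : VField E M) : contract v α ∈ DiffForm E M k := by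
  intro c u hu
  have h1 : ContDiffAt ℝ ∞ (fun y => (chartRep α c y).curryLeft (vecRep v c y)) u :=
    ContDiffAt.clm_apply (ContDiffAt.comp u (g := ⇑(ContinuousAlternatingMap.curryLeftLI (𝕜 := ℝ)
      (E := E) (F := ℝ) (n := k)).toContinuousLinearMap)
      (ContinuousLinearMap.contDiff _).contDiffAt (chartRep_contDiffAt hα hu))
      (vecRep_contDiffAt v.contMDiff hu)
  refine (h1.congr_of_eventuallyEq ?_).contDiffWithinAt
  filter_upwards [(isOpen_target c).mem_nhds hu] with y hy
  exact chartRep_contract v α hy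

/-- A function whose expression in all charts is smooth is smooth. -/
theorem contMDiff_of_charts {f : M → ℝ}
    (h : ∀ c : M, ∀ u ∈ (extChartAt 𝓘(ℝ, E) c).target,
      ContDiffAt ℝ ∞ (fun y => f ((extChartAt 𝓘(ℝ, E) c).symm y)) u) :
    ContMDiff 𝓘(ℝ, E) 𝓘(ℝ, ℝ) ∞ f := by
  intro x
  have hx := mem_extChartAt_target (I := 𝓘(ℝ, E)) x
  have h1 := (h x _ hx).contMDiffAt.comp x (chart_contMDiffAt (mem_extChartAt_source x))
  refine h1.congr_of_eventuallyEq ?_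
  filter_upwards [(isOpen_extChartAt_source (I := 𝓘(ℝ, E)) x).mem_nhds
    (mem_extChartAt_source x)] with y hy
  simp only [Function.comp_apply, (extChartAt 𝓘(ℝ, E) x).left_inv hy]

theorem fun_chart_contDiffAt (f : SmoothFun E M) {c : M} {u : E}
    (hu : u ∈ (extChartAt 𝓘(ℝ, E) c).target) :
    ContDiffAt ℝ ∞ (fun y => f ((extChartAt 𝓘(ℝ, E) c).symm y)) u :=
  ((f.contMDiff _).comp u (symm_contMDiffAt hu)).contDiffAt

theorem chartRep_rawDiff (f : SmoothFun E M) {c : M} {u : E}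
    (hu : u ∈ (extChartAt 𝓘(ℝ, E) c).target) :
    chartRep (rawDiff f) c u = ContinuousAlternatingMap.ofSubsingleton ℝ E ℝ 0
      (fderiv ℝ (fun y => f ((extChartAt 𝓘(ℝ, E) c).symm y)) u) := by
  have h1 := mfderiv_comp u ((f.contMDiff ((extChartAt 𝓘(ℝ, E) c).symm u)).mdifferentiableAt
    (by simp)) ((symm_contMDiffAt hu).mdifferentiableAt (by simp))
  rw [mfderiv_eq_fderiv] at h1
  have h2 : fderiv ℝ (fun y => f ((extChartAt 𝓘(ℝ, E) c).symm y)) u = _ := h1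
  rw [h2]
  rfl

theorem rawDiff_mem (f : SmoothFun E M) : rawDiff f ∈ DiffForm E M 1 := by
  intro c u hu
  have h1 := (fun_chart_contDiffAt f hu).fderiv_right (m := ∞) (by simp)
  have h2 : ContDiffAt ℝ ∞ (fun z => ContinuousAlternatingMap.ofSubsingletonLIE (𝕜 := ℝ) (E := E) (F := ℝ) (0 : Fin 1)
      (fderiv ℝ (fun y => f ((extChartAt 𝓘(ℝ, E) c).symm y)) z)) u :=
    (LinearIsometryEquiv.contDiff _).contDiffAt.comp u h1
  refine (h2.congr_of_eventuallyEq ?_).contDiffWithinAt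
  filter_upwards [(isOpen_target c).mem_nhds hu] with y hy
  exact chartRep_rawDiff f hy

/-- The differential `d : C^∞(M) → Ω¹(M)`. -/
def diff : SmoothFun E M →ₗ[ℝ] DiffForm E M 1 where
  toFun f := ⟨rawDiff f, rawDiff_mem f⟩
  map_add' f g := by
    apply Subtype.ext
    refine form_ext fun x => ?_
    have hx := mem_extChartAt_target (I := 𝓘(ℝ, E)) x
    have h2 : chartRep (rawDiff f + rawDiff g : RawForm E M 1) x (extChartAt 𝓘(ℝ, E) x x) =
      chartRep (rawDiff f) x (extChartAt 𝓘(ℝ, E) x x) +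
        chartRep (rawDiff g) x (extChartAt 𝓘(ℝ, E) x x) := rfl
    refine Eq.trans ?_ h2.symm
    rw [chartRep_rawDiff f hx, chartRep_rawDiff g hx]
    refine (chartRep_rawDiff (f + g) hx).trans ?_
    have h3 := fderiv_add ((fun_chart_contDiffAt f hx).differentiableAt (by simp))
      ((fun_chart_contDiffAt g hx).differentiableAt (by simp))
    refine (congrArg _ h3).trans ?_
    rfl
  map_smul' r f := by
    apply Subtype.ext
    refine form_ext fun x => ?_
    have hx := mem_extChartAt_target (I := 𝓘(ℝ, E)) x
    have h2 : chartRep (r • rawDiff f : RawForm E M 1) x (extChartAt 𝓘(ℝ, E) x x) =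
      r • chartRep (rawDiff f) x (extChartAt 𝓘(ℝ, E) x x) := rfl
    refine Eq.trans ?_ h2.symm
    rw [chartRep_rawDiff f hx]
    refine (chartRep_rawDiff (r • f) hx).trans ?_
    have h3 := fderiv_const_smul ((fun_chart_contDiffAt f hx).differentiableAt (by simp)) r
    refine (congrArg _ h3).trans ?_
    rfl

theorem extD_diff (f : SmoothFun E M) : extD (diff f).1 = 0 := by
  refine form_ext fun x => ?_
  have hx := mem_extChartAt_target (I := 𝓘(ℝ, E)) x
  have ev : chartRep (rawDiff f) x =ᶠ[𝓝 (extChartAt 𝓘(ℝ, E) x x)]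
      extDeriv (fun z => ContinuousAlternatingMap.constOfIsEmpty ℝ E (Fin 0)
        (f ((extChartAt 𝓘(ℝ, E) x).symm z))) := by
    filter_upwards [(isOpen_target x).mem_nhds hx] with y hy
    rw [extDeriv_constOfIsEmpty]
    exact chartRep_rawDiff f hy
  have hsm : ContDiffAt ℝ ∞ (fun z => ContinuousAlternatingMap.constOfIsEmpty ℝ E (Fin 0)
      (f ((extChartAt 𝓘(ℝ, E) x).symm z))) (extChartAt 𝓘(ℝ, E) x x) :=
    (ContinuousAlternatingMap.constOfIsEmptyLIE ℝ E ℝ (Fin 0)).contDiff.contDiffAt.comp _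
      (fun_chart_contDiffAt f hx)
  refine (chartRep_extD (rawDiff_mem f) hx).trans ?_
  rw [ev.extDeriv_eq, extDeriv_extDeriv_apply hsm (by simpa using ENat.LEInfty.out)]
  rfl

end Calculus

section LieAlgebra
variable {E : Type*} [NormedAddCommGroup E] [NormedSpace ℝ E] [FiniteDimensional ℝ E]
  {M : Type*} [TopologicalSpace M] [ChartedSpace E M] [IsManifold 𝓘(ℝ, E) ∞ M]

/-- The Lie bracket of vector fields makes `𝔛(M)` a Lie ring. -/
instance instLieRingVField : LieRing (VField E M) where
  bracket v w := ⟨mlieBracket 𝓘(ℝ, E) v w, by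
    have := FiniteDimensional.complete ℝ E
    have : IsManifold 𝓘(ℝ, E) (minSmoothness ℝ 2) M := isManifold_min 2
    have : IsManifold 𝓘(ℝ, E) ((⊤ : ℕ∞) + 1) M := by
      have h : (((⊤ : ℕ∞) : WithTop ℕ∞) + 1) = ∞ := rfl
      rw [h]; infer_instance
    exact ContDiff.mlieBracket_vectorField (m := ⊤) (n := ⊤) v.contMDiff w.contMDiff (by simp)⟩
  add_lie u v w := by
    have := FiniteDimensional.complete ℝ E
    ext x
    exact mlieBracket_add_left ((u.contMDiff x).mdifferentiableAt (by simp))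
      ((v.contMDiff x).mdifferentiableAt (by simp))
  lie_add u v w := by
    have := FiniteDimensional.complete ℝ E
    ext x
    exact mlieBracket_add_right ((v.contMDiff x).mdifferentiableAt (by simp))
      ((w.contMDiff x).mdifferentiableAt (by simp))
  lie_self v := by
    ext x
    have h : (mlieBracket 𝓘(ℝ, E) v v x : E) = - mlieBracket 𝓘(ℝ, E) v v x :=
      mlieBracket_swap_apply
    have key : ∀ z : E, z = -z → z = 0 := fun z hz => by
      have h2 : (2 : ℝ) • z = 0 := by
        rw [two_smul]
        exact add_eq_zero_iff_eq_neg.mpr hz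
      exact (smul_eq_zero.mp h2).resolve_left two_ne_zero
    exact key _ h
  leibniz_lie u v w := by
    have := FiniteDimensional.complete ℝ E
    have : IsManifold 𝓘(ℝ, E) (minSmoothness ℝ 3) M := isManifold_min 3
    ext x
    have h2 : minSmoothness ℝ 2 ≤ ∞ := by simpa using ENat.LEInfty.out
    exact leibniz_identity_mlieBracket_apply ((u.contMDiff x).of_le h2) ((v.contMDiff x).of_le h2)
      ((w.contMDiff x).of_le h2)

theorem lie_coe (v w : VField E M) : (⇑⁅v, w⁆ : ∀ x : M, TangentSpace 𝓘(ℝ, E) x) =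
    mlieBracket 𝓘(ℝ, E) v w := rfl

instance instLieAlgebraVField : LieAlgebra ℝ (VField E M) where
  lie_smul r v w := by
    have := FiniteDimensional.complete ℝ E
    ext x
    exact mlieBracket_const_smul_right ((w.contMDiff x).mdifferentiableAt (by simp))

end LieAlgebra

section TwoPlectic
variable {E : Type*} [NormedAddCommGroup E] [NormedSpace ℝ E]
  {M : Type*} [TopologicalSpace M] [ChartedSpace E M]

/-- A 2-plectic structure on `M`: a smooth 3-form which is closed and nondegenerate. -/
structure TwoPlecticForm (E : Type*) [NormedAddCommGroup E] [NormedSpace ℝ E]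
    (M : Type*) [TopologicalSpace M] [ChartedSpace E M] where
  form : DiffForm E M 3
  closed : extD form.1 = 0
  nondegenerate : ∀ (x : M) (v : TangentSpace 𝓘(ℝ, E) x),
    (∀ a b : TangentSpace 𝓘(ℝ, E) x, form.1 x ![v, a, b] = 0) → v = 0

variable [IsManifold 𝓘(ℝ, E) ∞ M] (Ω : TwoPlecticForm E M)

/-- `v` is a Hamiltonian vector field of the 1-form `α`: `dα = -ι_v Ω`. -/
def IsHamiltonianPair (α : DiffForm E M 1) (v : VField E M) : Prop :=
  extD α.1 = - contract v Ω.form.1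

variable {Ω}

theorem contract_add {k : ℕ} (v w : VField E M) (α : RawForm E M (k + 1)) :
    contract (v + w : VField E M) α = contract v α + contract w α :=
  funext fun x => map_add (ContinuousAlternatingMap.curryLeft (E := E) (α x)) (v x) (w x)

theorem contract_smul {k : ℕ} (r : ℝ) (v : VField E M) (α : RawForm E M (k + 1)) :
    contract (r • v : VField E M) α = r • contract v α :=
  funext fun x => map_smul (ContinuousAlternatingMap.curryLeft (E := E) (α x)) r (v x)

theorem contract_zero {k : ℕ} (α : RawForm E M (k + 1)) :
    contract (0 : VField E M) α = 0 :=
  funext fun x => map_zero (ContinuousAlternatingMap.curryLeft (E := E) (α x))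

theorem isHam_zero : IsHamiltonianPair Ω 0 0 := by
  have h := extD_smul (E := E) (M := M) 0 (0 : RawForm E M 1)
  rw [zero_smul, zero_smul] at h
  rw [IsHamiltonianPair, contract_zero, neg_zero]
  exact h

theorem IsHamiltonianPair.add {α β : DiffForm E M 1} {v w : VField E M}
    (h : IsHamiltonianPair Ω α v) (h' : IsHamiltonianPair Ω β w) :
    IsHamiltonianPair Ω (α + β) (v + w) := by
  rw [IsHamiltonianPair] at *
  rw [contract_add, neg_add, ← h, ← h']
  exact extD_add α.2 β.2

theorem IsHamiltonianPair.smul (r : ℝ) {α : DiffForm E M 1} {v : VField E M}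
    (h : IsHamiltonianPair Ω α v) : IsHamiltonianPair Ω (r • α) (r • v) := by
  rw [IsHamiltonianPair] at *
  rw [contract_smul]
  exact (extD_smul r α.1).trans ((congrArg (r • ·) h).trans
    (smul_neg (A := RawForm E M 2) r (contract v Ω.form.1)))

theorem IsHamiltonianPair.unique {α : DiffForm E M 1} {v w : VField E M}
    (h : IsHamiltonianPair Ω α v) (h' : IsHamiltonianPair Ω α w) : v = w := by
  have h0 : contract (v + (-1 : ℝ) • w : VField E M) Ω.form.1 = 0 := by
    rw [contract_add, contract_smul]
    have e : contract v Ω.form.1 = contract w Ω.form.1 := neg_injective (h.symm.trans h')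
    rw [e]
    exact (congrArg (contract w Ω.form.1 + ·) (neg_one_smul ℝ (contract w Ω.form.1))).trans
      (add_neg_cancel (contract w Ω.form.1))
  have h1 : v + (-1 : ℝ) • w = 0 := by
    ext x
    refine Ω.nondegenerate x _ fun a b => ?_
    exact congrArg (fun f => f ![a, b]) (congrFun h0 x)
  rw [neg_one_smul, ← sub_eq_add_neg, sub_eq_zero] at h1
  exact h1

theorem closed_chart {c : M} {u : E} (hu : u ∈ (extChartAt 𝓘(ℝ, E) c).target) :
    extDeriv (chartRep Ω.form.1 c) u = 0 := by
  rw [← chartRep_extD Ω.form.2 hu, Ω.closed]; rfl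

theorem IsHamiltonianPair.chart {α : DiffForm E M 1} {v : VField E M}
    (h : IsHamiltonianPair Ω α v) {c : M} {u : E} (hu : u ∈ (extChartAt 𝓘(ℝ, E) c).target) :
    extDeriv (fun y => (chartRep Ω.form.1 c y).curryLeft (vecRep v c y)) u = 0 := by
  have ev : (fun y => (chartRep Ω.form.1 c y).curryLeft (vecRep v c y)) =ᶠ[𝓝 u]
      (-1 : ℝ) • extDeriv (chartRep α.1 c) := by
    filter_upwards [(isOpen_target c).mem_nhds hu] with y hy
    rw [Pi.smul_apply, ← chartRep_extD α.2 hy, h, ← chartRep_contract _ _ hy, neg_one_smul]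
    exact (neg_neg (chartRep (contract v Ω.form.1) c y)).symm
  rw [ev.extDeriv_eq, extDeriv_smul, extDeriv_extDeriv_apply (chartRep_contDiffAt α.2 hu)
    (by simpa using ENat.LEInfty.out), smul_zero]

variable [FiniteDimensional ℝ E]

theorem vecRep_diff (v : VField E M) {c : M} {u : E} (hu : u ∈ (extChartAt 𝓘(ℝ, E) c).target) :
    DifferentiableAt ℝ (vecRep v c) u :=
  have := FiniteDimensional.complete ℝ E
  (vecRep_contDiffAt v.contMDiff hu).differentiableAt (by simp)

theorem vecRep_lie (v w : VField E M) {c : M} {u : E}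
    (hu : u ∈ (extChartAt 𝓘(ℝ, E) c).target) :
    vecRep (⁅v, w⁆ : VField E M) c u = lieBracket ℝ (vecRep v c) (vecRep w c) u :=
  have := FiniteDimensional.complete ℝ E
  vecRep_mlieBracket v.contMDiff w.contMDiff hu

theorem form_diff {c : M} {u : E} (hu : u ∈ (extChartAt 𝓘(ℝ, E) c).target) :
    DifferentiableAt ℝ (chartRep Ω.form.1 c) u :=
  (chartRep_contDiffAt Ω.form.2 hu).differentiableAt (by simp)

/-- The 1-form `Ω(v, w, ·) = ι_w ι_v Ω`. -/
def contract₂ (Ω : TwoPlecticForm E M) (v w : VField E M) : DiffForm E M 1 :=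
  ⟨contract w (contract v Ω.form.1), have := FiniteDimensional.complete ℝ E
    contract_mem (contract_mem Ω.form.2 v) w⟩

/-- `d(ι_w ι_v Ω) = -ι_[v,w] Ω` for Hamiltonian vector fields `v, w`. -/
theorem isHam_bracket {α β : DiffForm E M 1} {v w : VField E M}
    (h : IsHamiltonianPair Ω α v) (h' : IsHamiltonianPair Ω β w) :
    IsHamiltonianPair Ω (contract₂ Ω v w) ⁅v, w⁆ := by
  refine form_ext fun x => ?_
  have hx := mem_extChartAt_target (I := 𝓘(ℝ, E)) x
  rw [chartRep_extD (contract₂ Ω v w).2 hx]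
  have ev : chartRep (contract₂ Ω v w).1 x =ᶠ[𝓝 (extChartAt 𝓘(ℝ, E) x x)] fun y =>
      ((chartRep Ω.form.1 x y).curryLeft (vecRep v x y)).curryLeft (vecRep w x y) := by
    filter_upwards [(isOpen_target x).mem_nhds hx] with y hy
    rw [← chartRep_contract _ _ hy, ← chartRep_contract _ _ hy]
    rfl
  rw [ev.extDeriv_eq, extDeriv_curry_curry (form_diff hx) (vecRep_diff v hx) (vecRep_diff w hx)
    (closed_chart hx) (h.chart hx) (h'.chart hx), ← vecRep_lie v w hx,
    ← chartRep_contract _ _ hx]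
  rfl

theorem form_apply (u v w : VField E M) (x c : M) (hx : x ∈ (extChartAt 𝓘(ℝ, E) c).source) :
    Ω.form.1 x ![u x, v x, w x] = chartRep Ω.form.1 c (extChartAt 𝓘(ℝ, E) c x)
      ![vecRep u c (extChartAt 𝓘(ℝ, E) c x), vecRep v c (extChartAt 𝓘(ℝ, E) c x),
        vecRep w c (extChartAt 𝓘(ℝ, E) c x)] := by
  have hx' := (extChartAt 𝓘(ℝ, E) c).map_source hx
  have h : Ω.form.1 x ![u x, v x, w x] =
    contract w (contract v (contract u Ω.form.1)) x ![] := rfl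
  have h' : chartRep (contract w (contract v (contract u Ω.form.1))) c (extChartAt 𝓘(ℝ, E) c x) ![]
      = contract w (contract v (contract u Ω.form.1)) x ![] := by
    rw [eq_chartRep_comp (contract w (contract v (contract u Ω.form.1))) hx]
    exact congrArg (chartRep (contract w (contract v (contract u Ω.form.1))) c
      (extChartAt 𝓘(ℝ, E) c x)) (Subsingleton.elim _ _)
  rw [h, ← h', chartRep_contract _ _ hx', chartRep_contract _ _ hx', chartRep_contract _ _ hx']
  rfl

/-- The function `Ω(u, v, w)`. -/
def contract₃ (Ω : TwoPlecticForm E M) (u v w : VField E M) : SmoothFun E M :=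
  ⟨fun x => Ω.form.1 x ![u x, v x, w x], by
    have := FiniteDimensional.complete ℝ E
    refine contMDiff_of_charts fun c y hy => ?_
    have h2 := chartRep_contDiffAt (contract_mem (contract_mem (contract_mem Ω.form.2 u) v) w) hy
    have h3 := (ContinuousAlternatingMap.constOfIsEmptyLIE ℝ E ℝ (Fin 0)).symm.contDiff.contDiffAt
      (n := ∞) |>.comp _ h2
    refine h3.congr_of_eventuallyEq (Filter.Eventually.of_forall fun z => ?_)
    exact congrArg (contract w (contract v (contract u Ω.form.1))
      ((extChartAt 𝓘(ℝ, E) c).symm z)) (Subsingleton.elim _ _)⟩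

end TwoPlectic

section Lie2

/-- A (semistrict) Lie 2-algebra structure on the real vector spaces `L₁` (degree 1) and `L₀`
(degree 0).

The skew-symmetric chain map `[·,·] : L ⊗ L → L` consists of `br` on `L₀ ⊗ L₀` and of
`act x h = [x, h] = -[h, x]` for `x ∈ L₀`, `h ∈ L₁`; it vanishes on `L₁ ⊗ L₁` for degree reasons.
The Jacobiator is a skew-symmetric chain homotopy from `[x,[y,z]]` to `[[x,y],z] + [y,[x,z]]`;
a chain homotopy `H` from `F` to `G` satisfies `F - G = d H + H d`. -/
structure Lie2Algebra (L₁ L₀ : Type*) [AddCommGroup L₁] [Module ℝ L₁]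
    [AddCommGroup L₀] [Module ℝ L₀] where
  /-- the differential of the complex -/
  d : L₁ →ₗ[ℝ] L₀
  /-- the bracket on `L₀` -/
  br : L₀ →ₗ[ℝ] L₀ →ₗ[ℝ] L₀
  /-- the bracket of an element of `L₀` and an element of `L₁` -/
  act : L₀ →ₗ[ℝ] L₁ →ₗ[ℝ] L₁
  /-- the Jacobiator -/
  J : L₀ →ₗ[ℝ] L₀ →ₗ[ℝ] L₀ →ₗ[ℝ] L₁
  br_skew : ∀ x y, br x y = -br y x
  /-- the bracket is a chain map, on `L₀ ⊗ L₁` -/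
  d_act : ∀ x h, d (act x h) = br x (d h)
  /-- the bracket is a chain map, on `L₁ ⊗ L₁` -/
  act_d : ∀ h k, act (d h) k + act (d k) h = 0
  J_skew_left : ∀ x y z, J x y z = -J y x z
  J_skew_right : ∀ x y z, J x y z = -J x z y
  /-- the homotopy identity in degree 0 -/
  d_J : ∀ x y z, br x (br y z) - (br (br x y) z + br y (br x z)) = d (J x y z)
  /-- the homotopy identity in degree 1 -/
  J_d : ∀ x y h, act x (act y h) - (act (br x y) h + act y (act x h)) = J x y (d h)
  /-- the coherence law for the Jacobiator, where `[J(x,y,z), w] = -act w (J x y z)` -/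
  J_coherence : ∀ x y z w,
    act x (J y z w) + J x (br y z) w + J x z (br y w) + -act w (J x y z) + act z (J x y w) =
      J x y (br z w) + J (br x y) z w + act y (J x z w) + J y (br x z) w + J y z (br x w)

variable {L₁ L₀ L₁' L₀' L₁'' L₀'' : Type*}
  [AddCommGroup L₁] [Module ℝ L₁] [AddCommGroup L₀] [Module ℝ L₀]
  [AddCommGroup L₁'] [Module ℝ L₁'] [AddCommGroup L₀'] [Module ℝ L₀']
  [AddCommGroup L₁''] [Module ℝ L₁''] [AddCommGroup L₀''] [Module ℝ L₀'']

/-- A morphism of Lie 2-algebras: a chain map `(φ₁, φ₀)` and a skew-symmetric chain homotopy `Φ`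
from `φ[x, y]` to `[φ x, φ y]'`, subject to the coherence law. -/
structure Lie2Hom (L : Lie2Algebra L₁ L₀) (L' : Lie2Algebra L₁' L₀') where
  φ₁ : L₁ →ₗ[ℝ] L₁'
  φ₀ : L₀ →ₗ[ℝ] L₀'
  Φ : L₀ →ₗ[ℝ] L₀ →ₗ[ℝ] L₁'
  /-- chain map -/
  comm : ∀ h, φ₀ (L.d h) = L'.d (φ₁ h)
  Φ_skew : ∀ x y, Φ x y = -Φ y x
  /-- the homotopy identity in degree 0 -/
  d_Φ : ∀ x y, φ₀ (L.br x y) - L'.br (φ₀ x) (φ₀ y) = L'.d (Φ x y)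
  /-- the homotopy identity in degree 1 -/
  Φ_d : ∀ x h, φ₁ (L.act x h) - L'.act (φ₀ x) (φ₁ h) = Φ x (L.d h)
  /-- the coherence law, where `[Φ(x,y), φ₀ z]' = -L'.act (φ₀ z) (Φ x y)` -/
  coherence : ∀ x y z, φ₁ (L.J x y z) - L'.J (φ₀ x) (φ₀ y) (φ₀ z) =
    Φ x (L.br y z) - Φ (L.br x y) z - Φ y (L.br x z) - -L'.act (φ₀ z) (Φ x y)
      + L'.act (φ₀ x) (Φ y z) - L'.act (φ₀ y) (Φ x z)

namespace Lie2Hom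
variable {L : Lie2Algebra L₁ L₀} {L' : Lie2Algebra L₁' L₀'} (f : Lie2Hom L L')

/-- The map induced on the homology in degree 1, `H₁ = ker d`. -/
def mapH₁ : LinearMap.ker L.d →ₗ[ℝ] LinearMap.ker L'.d :=
  f.φ₁.restrict fun h hh => by
    rw [LinearMap.mem_ker] at *
    rw [← f.comm, hh, map_zero]

/-- The map induced on the homology in degree 0, `H₀ = L₀ / im d`. -/
def mapH₀ : (L₀ ⧸ LinearMap.range L.d) →ₗ[ℝ] (L₀' ⧸ LinearMap.range L'.d) :=
  Submodule.mapQ _ _ f.φ₀ <| by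
    rintro _ ⟨h, rfl⟩
    exact ⟨f.φ₁ h, (f.comm h).symm⟩

/-- A quasi-isomorphism: a morphism inducing isomorphisms on the homology. -/
def IsQuasiIso : Prop := Function.Bijective f.mapH₁ ∧ Function.Bijective f.mapH₀

end Lie2Hom

/-- `L'` is a strict central extension of `L''` by `L`: there are morphisms `L → L' → L''` whose
underlying chain maps form a short exact sequence of complexes, and the image of `L` is central,
`[im φ, L']' = 0`. -/
def IsStrictCentralExtension (L : Lie2Algebra L₁ L₀) (L' : Lie2Algebra L₁' L₀')
    (L'' : Lie2Algebra L₁'' L₀'') : Prop :=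
  ∃ (f : Lie2Hom L L') (g : Lie2Hom L' L''),
    (Function.Injective f.φ₁ ∧ Function.Exact f.φ₁ g.φ₁ ∧ Function.Surjective g.φ₁) ∧
    (Function.Injective f.φ₀ ∧ Function.Exact f.φ₀ g.φ₀ ∧ Function.Surjective g.φ₀) ∧
    (∀ x y, L'.br (f.φ₀ x) y = 0) ∧ (∀ x h, L'.act (f.φ₀ x) h = 0) ∧
    (∀ h y, L'.act y (f.φ₁ h) = 0)

/-- The abelian Lie 2-algebra on a 2-term complex: all brackets and the Jacobiator vanish. -/
def abelianLie2 (d : L₁ →ₗ[ℝ] L₀) : Lie2Algebra L₁ L₀ where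
  d := d
  br := 0
  act := 0
  J := 0
  br_skew := by simp
  d_act := by simp
  act_d := by simp
  J_skew_left := by simp
  J_skew_right := by simp
  d_J := by simp
  J_d := by simp
  J_coherence := by simp

/-- The abelian Lie 2-algebra `b𝔲(1)`, with underlying complex `ℝ → 0`. -/
def bu1 : Lie2Algebra ℝ PUnit.{1} := abelianLie2 0

/-- A Lie algebra as a trivial Lie 2-algebra, with underlying complex `0 → 𝔤`. -/
def trivialLie2 (𝔤 : Type*) [LieRing 𝔤] [LieAlgebra ℝ 𝔤] : Lie2Algebra PUnit.{1} 𝔤 where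
  d := 0
  br := LieModule.toEnd ℝ 𝔤 𝔤
  act := 0
  J := 0
  br_skew x y := (lie_skew x y).symm
  d_act := by simp
  act_d := by simp
  J_skew_left := by simp
  J_skew_right := by simp
  d_J x y z := by simp
  J_d := by simp
  J_coherence := by simp

/-- A trilinear map from a function of three variables linear in each variable. -/
def mkTrilinear (f : L₀ → L₀ → L₀ → L₁)
    (a₁ : ∀ x x' y z, f (x + x') y z = f x y z + f x' y z)
    (s₁ : ∀ (r : ℝ) x y z, f (r • x) y z = r • f x y z)
    (a₂ : ∀ x y y' z, f x (y + y') z = f x y z + f x y' z)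
    (s₂ : ∀ (r : ℝ) x y z, f x (r • y) z = r • f x y z)
    (a₃ : ∀ x y z z', f x y (z + z') = f x y z + f x y z')
    (s₃ : ∀ (r : ℝ) x y z, f x y (r • z) = r • f x y z) :
    L₀ →ₗ[ℝ] L₀ →ₗ[ℝ] L₀ →ₗ[ℝ] L₁ where
  toFun x := LinearMap.mk₂ ℝ (f x) (a₂ x) (fun r y z => s₂ r x y z) (a₃ x) (fun r y z => s₃ r x y z)
  map_add' x x' := by ext y z; exact a₁ x x' y z
  map_smul' r x := by ext y z; exact s₁ r x y z

end Lie2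

section Observables
variable {E : Type*} [NormedAddCommGroup E] [NormedSpace ℝ E] [FiniteDimensional ℝ E]
  {M : Type*} [TopologicalSpace M] [ChartedSpace E M] [IsManifold 𝓘(ℝ, E) ∞ M]

/-- The Hamiltonian 1-forms `Ω¹_Ham(M)`. -/
def HamForm (Ω : TwoPlecticForm E M) : Submodule ℝ (DiffForm E M 1) where
  carrier := {α | ∃ v : VField E M, IsHamiltonianPair Ω α v}
  zero_mem' := ⟨0, isHam_zero⟩
  add_mem' := by
    rintro _ _ ⟨v, h⟩ ⟨w, h'⟩
    exact ⟨v + w, h.add h'⟩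
  smul_mem' := by
    rintro r _ ⟨v, h⟩
    exact ⟨r • v, h.smul r⟩

/-- The usual vector space structure of a subspace (the instance search needs help here). -/
instance instAddCommGroupHamForm (Ω : TwoPlecticForm E M) : AddCommGroup (HamForm Ω) :=
  @Submodule.addCommGroup ℝ (DiffForm E M 1) _ _ _ (HamForm Ω)

/-- The Lie algebra `𝔛_Ham(M)` of Hamiltonian vector fields. -/
def HamVField (Ω : TwoPlecticForm E M) : LieSubalgebra ℝ (VField E M) where
  carrier := {v | ∃ α : DiffForm E M 1, IsHamiltonianPair Ω α v}
  zero_mem' := ⟨0, isHam_zero⟩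
  add_mem' := by
    rintro _ _ ⟨α, h⟩ ⟨β, h'⟩
    exact ⟨α + β, h.add h'⟩
  smul_mem' := by
    rintro r _ ⟨α, h⟩
    exact ⟨r • α, h.smul r⟩
  lie_mem' := by
    rintro v w ⟨α, h⟩ ⟨β, h'⟩
    exact ⟨contract₂ Ω v w, isHam_bracket h h'⟩

variable (Ω : TwoPlecticForm E M)

/-- The Hamiltonian vector field `v_α` of a Hamiltonian 1-form `α`. -/
def hamVec (α : HamForm Ω) : VField E M := Classical.choose α.2

theorem hamVec_spec (α : HamForm Ω) : IsHamiltonianPair Ω α.1 (hamVec Ω α) :=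
  Classical.choose_spec α.2

variable {Ω}

theorem hamVec_eq {α : HamForm Ω} {v : VField E M} (h : IsHamiltonianPair Ω α.1 v) :
    hamVec Ω α = v := (hamVec_spec Ω α).unique h

theorem hamVec_add (α β : HamForm Ω) : hamVec Ω (α + β) = hamVec Ω α + hamVec Ω β :=
  hamVec_eq ((hamVec_spec Ω α).add (hamVec_spec Ω β))

theorem hamVec_smul (r : ℝ) (α : HamForm Ω) : hamVec Ω (r • α) = r • hamVec Ω α :=
  hamVec_eq ((hamVec_spec Ω α).smul r)

variable (Ω)

/-- The differential `d : C^∞(M) → Ω¹_Ham(M)`. -/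
def diffHam : SmoothFun E M →ₗ[ℝ] HamForm Ω :=
  LinearMap.codRestrict (HamForm Ω) diff fun f =>
    ⟨0, by
      rw [IsHamiltonianPair, contract_zero, extD_diff]
      exact neg_zero.symm⟩

theorem hamVec_diffHam (f : SmoothFun E M) : hamVec Ω (diffHam Ω f) = 0 :=
  hamVec_eq <| by
    rw [IsHamiltonianPair, contract_zero]
    exact (extD_diff f).trans neg_zero.symm

/-- The cocycle identity for `(u, v, w) ↦ ι_u ι_v ι_w Ω` at every point. -/
theorem ham_cocycle {u v w z : VField E M} (hu : u ∈ HamVField Ω) (hv : v ∈ HamVField Ω)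
    (hw : w ∈ HamVField Ω) (hz : z ∈ HamVField Ω) (x : M) :
    Ω.form.1 x ![z x, ⁅v, w⁆ x, u x] + Ω.form.1 x ![⁅v, z⁆ x, w x, u x] =
      Ω.form.1 x ![⁅w, z⁆ x, v x, u x] + Ω.form.1 x ![z x, w x, ⁅u, v⁆ x]
        + Ω.form.1 x ![z x, ⁅u, w⁆ x, v x] + Ω.form.1 x ![⁅u, z⁆ x, w x, v x] := by
  obtain ⟨α, hu⟩ := hu
  obtain ⟨β, hv⟩ := hv
  obtain ⟨γ, hw⟩ := hw
  obtain ⟨δ, hz⟩ := hz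
  have hx := mem_extChartAt_target (I := 𝓘(ℝ, E)) x
  have hs := mem_extChartAt_source (I := 𝓘(ℝ, E)) x
  simp only [form_apply _ _ _ x x hs, vecRep_lie _ _ hx]
  exact cocycle_local (form_diff hx) (vecRep_diff u hx) (vecRep_diff v hx) (vecRep_diff w hx)
    (vecRep_diff z hx) (closed_chart hx) (hu.chart hx) (hv.chart hx) (hw.chart hx) (hz.chart hx)

/-- The Lie 2-algebra `L_∞(𝔛_Ham(M), x)`: the complex `0 : ℝ → 𝔛_Ham(M)`, the Lie bracket of vector
fields in degree 0, and the Jacobiator `J_x(v₁, v₂, v₃) = ι_{v₁} ι_{v₂} ι_{v₃} Ω |_x`. -/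
def lieTwoHam (x : M) : Lie2Algebra ℝ (HamVField Ω) where
  d := 0
  br := LieModule.toEnd ℝ (HamVField Ω) (HamVField Ω)
  act := 0
  J := mkTrilinear (fun v₁ v₂ v₃ => Ω.form.1 x ![v₃.1 x, v₂.1 x, v₁.1 x])
    (fun _ _ _ _ => add3_3 (E := E) (Ω.form.1 x) _ _ _ _)
    (fun _ _ _ _ => smul3_3 (E := E) (Ω.form.1 x) _ _ _ _)
    (fun _ _ _ _ => add3_2 (E := E) (Ω.form.1 x) _ _ _ _)
    (fun _ _ _ _ => smul3_2 (E := E) (Ω.form.1 x) _ _ _ _)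
    (fun _ _ _ _ => add3_1 (E := E) (Ω.form.1 x) _ _ _ _)
    (fun _ _ _ _ => smul3_1 (E := E) (Ω.form.1 x) _ _ _ _)
  br_skew v w := (lie_skew v w).symm
  d_act := by simp
  act_d := by simp
  J_skew_left _ _ _ := alt3_12 (E := E) (Ω.form.1 x) _ _ _
  J_skew_right _ _ _ := alt3_01 (E := E) (Ω.form.1 x) _ _ _
  d_J u v w := by simp
  J_d := by simp
  J_coherence u v w z := by
    have h := ham_cocycle Ω u.2 v.2 w.2 z.2 x
    simp only [LinearMap.zero_apply, neg_zero, zero_add, add_zero]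
    exact h

/-- The bracket `{α, β} = ι_{v_β} ι_{v_α} Ω` of Hamiltonian 1-forms. -/
def hamBracket (α β : HamForm Ω) : HamForm Ω :=
  ⟨contract₂ Ω (hamVec Ω α) (hamVec Ω β), ⁅hamVec Ω α, hamVec Ω β⁆,
    isHam_bracket (hamVec_spec Ω α) (hamVec_spec Ω β)⟩

theorem hamVec_hamBracket (α β : HamForm Ω) :
    hamVec Ω (hamBracket Ω α β) = ⁅hamVec Ω α, hamVec Ω β⁆ :=
  hamVec_eq (isHam_bracket (hamVec_spec Ω α) (hamVec_spec Ω β))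

theorem hamForm_ext {α β : HamForm Ω} (h : ∀ (x : M) (p : TangentSpace 𝓘(ℝ, E) x),
    α.1.1 x ![p] = β.1.1 x ![p]) : α = β := by
  apply Subtype.ext
  apply Subtype.ext
  funext x
  apply ContinuousAlternatingMap.ext
  intro p
  have e : p = ![p 0] := by ext i; fin_cases i; rfl
  rw [e]
  exact h x (p 0)

theorem hamBracket_apply (α β : HamForm Ω) (x : M) (p : TangentSpace 𝓘(ℝ, E) x) :
    (hamBracket Ω α β).1.1 x ![p] = Ω.form.1 x ![hamVec Ω α x, hamVec Ω β x, p] := rfl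

theorem diffHam_apply (f : SmoothFun E M) (x : M) (p : TangentSpace 𝓘(ℝ, E) x) :
    (diffHam Ω f).1.1 x ![p] = mfderiv 𝓘(ℝ, E) 𝓘(ℝ, ℝ) f x p := rfl

theorem oneForm_apply (α : RawForm E M 1) (x : M) (p : TangentSpace 𝓘(ℝ, E) x) :
    α x ![p] = chartRep α x (extChartAt 𝓘(ℝ, E) x x) ![dChart x x p] := by
  have h : ∀ B : E [⋀^Fin 1]→L[ℝ] ℝ, ∀ A : E →L[ℝ] E, ∀ q : E,
      B.compContinuousLinearMap A ![q] = B ![A q] := by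
    intro B A q
    rw [ContinuousAlternatingMap.compContinuousLinearMap_apply]
    congr 1
    ext i; fin_cases i; rfl
  exact (congrArg (fun f : TangentSpace 𝓘(ℝ, E) x [⋀^Fin 1]→L[ℝ] ℝ => f ![p])
    (eq_chartRep_comp α (mem_extChartAt_source x))).trans (h _ _ p)

theorem form_apply₂ (v w : VField E M) (x : M) (p : TangentSpace 𝓘(ℝ, E) x) :
    Ω.form.1 x ![v x, w x, p] = chartRep Ω.form.1 x (extChartAt 𝓘(ℝ, E) x x)
      ![vecRep v x (extChartAt 𝓘(ℝ, E) x x), vecRep w x (extChartAt 𝓘(ℝ, E) x x),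
        dChart x x p] := by
  have hx := mem_extChartAt_target (I := 𝓘(ℝ, E)) x
  have h := oneForm_apply (contract w (contract v Ω.form.1)) x p
  rw [chartRep_contract _ _ hx, chartRep_contract _ _ hx] at h
  exact h

/-- The Jacobi identity up to an exact form. -/
theorem hamBracket_jacobi (α β γ : HamForm Ω) :
    hamBracket Ω α (hamBracket Ω β γ) -
      (hamBracket Ω (hamBracket Ω α β) γ + hamBracket Ω β (hamBracket Ω α γ)) =
    diffHam Ω (contract₃ Ω (hamVec Ω γ) (hamVec Ω β) (hamVec Ω α)) := by
  apply hamForm_ext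
  intro x p
  have hx := mem_extChartAt_target (I := 𝓘(ℝ, E)) x
  have hl : (hamBracket Ω α (hamBracket Ω β γ) -
      (hamBracket Ω (hamBracket Ω α β) γ + hamBracket Ω β (hamBracket Ω α γ))).1.1 x ![p] =
      Ω.form.1 x ![hamVec Ω α x, hamVec Ω (hamBracket Ω β γ) x, p] -
        (Ω.form.1 x ![hamVec Ω (hamBracket Ω α β) x, hamVec Ω γ x, p] +
          Ω.form.1 x ![hamVec Ω β x, hamVec Ω (hamBracket Ω α γ) x, p]) := rfl
  have hr : (diffHam Ω (contract₃ Ω (hamVec Ω γ) (hamVec Ω β) (hamVec Ω α))).1.1 x ![p] = _ :=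
    oneForm_apply (rawDiff (contract₃ Ω (hamVec Ω γ) (hamVec Ω β) (hamVec Ω α))) x p
  have ev : (fun y => contract₃ Ω (hamVec Ω γ) (hamVec Ω β) (hamVec Ω α)
      ((extChartAt 𝓘(ℝ, E) x).symm y)) =ᶠ[𝓝 (extChartAt 𝓘(ℝ, E) x x)]
      fun y => chartRep Ω.form.1 x y ![vecRep (hamVec Ω γ) x y, vecRep (hamVec Ω β) x y,
        vecRep (hamVec Ω α) x y] := by
    filter_upwards [(isOpen_target x).mem_nhds hx] with y hy
    have h := form_apply (Ω := Ω) (hamVec Ω γ) (hamVec Ω β) (hamVec Ω α) _ x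
      ((extChartAt 𝓘(ℝ, E) x).map_target hy)
    rw [(extChartAt 𝓘(ℝ, E) x).right_inv hy] at h
    exact h
  rw [chartRep_rawDiff _ hx, ev.fderiv_eq] at hr
  rw [hl, hr]
  simp only [hamVec_hamBracket, form_apply₂, vecRep_lie _ _ hx]
  exact (fderiv_contract (form_diff hx) (vecRep_diff _ hx) (vecRep_diff _ hx) (vecRep_diff _ hx)
    (closed_chart hx) ((hamVec_spec Ω α).chart hx) ((hamVec_spec Ω β).chart hx)
    ((hamVec_spec Ω γ).chart hx) _).symm

/-- The Lie 2-algebra `L_∞(M, Ω)` of observables: the complex `d : C^∞(M) → Ω¹_Ham(M)`, the bracket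
`{·, ·}` in degree 0 (all other brackets vanish), and the Jacobiator
`J(α, β, γ) = ι_{v_α} ι_{v_β} ι_{v_γ} Ω`. -/
def lieTwoObs : Lie2Algebra (SmoothFun E M) (HamForm Ω) where
  d := diffHam Ω
  br := LinearMap.mk₂ ℝ (hamBracket Ω)
    (fun α α' β => hamForm_ext Ω fun x p => by
      rw [hamBracket_apply, hamVec_add]
      exact add3_1 (E := E) (Ω.form.1 x) _ _ _ _)
    (fun r α β => hamForm_ext Ω fun x p => by
      rw [hamBracket_apply, hamVec_smul]
      exact smul3_1 (E := E) (Ω.form.1 x) _ _ _ _)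
    (fun α β β' => hamForm_ext Ω fun x p => by
      rw [hamBracket_apply, hamVec_add]
      exact add3_2 (E := E) (Ω.form.1 x) _ _ _ _)
    (fun r α β => hamForm_ext Ω fun x p => by
      rw [hamBracket_apply, hamVec_smul]
      exact smul3_2 (E := E) (Ω.form.1 x) _ _ _ _)
  act := 0
  J := mkTrilinear (fun α β γ => contract₃ Ω (hamVec Ω γ) (hamVec Ω β) (hamVec Ω α))
    (fun _ _ _ _ => by
      ext x; rw [hamVec_add]; exact add3_3 (E := E) (Ω.form.1 x) _ _ _ _)
    (fun _ _ _ _ => by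
      ext x; rw [hamVec_smul]; exact smul3_3 (E := E) (Ω.form.1 x) _ _ _ _)
    (fun _ _ _ _ => by
      ext x; rw [hamVec_add]; exact add3_2 (E := E) (Ω.form.1 x) _ _ _ _)
    (fun _ _ _ _ => by
      ext x; rw [hamVec_smul]; exact smul3_2 (E := E) (Ω.form.1 x) _ _ _ _)
    (fun _ _ _ _ => by
      ext x; rw [hamVec_add]; exact add3_1 (E := E) (Ω.form.1 x) _ _ _ _)
    (fun _ _ _ _ => by
      ext x; rw [hamVec_smul]; exact smul3_1 (E := E) (Ω.form.1 x) _ _ _ _)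
  br_skew α β := hamForm_ext Ω fun x _ => alt3_01 (E := E) (Ω.form.1 x) _ _ _
  d_act α f := hamForm_ext Ω fun x p => by
    have h : Ω.form.1 x ![hamVec Ω α x, hamVec Ω (diffHam Ω f) x, p] = 0 := by
      rw [hamVec_diffHam]
      have h0 := smul3_2 (E := E) (Ω.form.1 x) 0 (hamVec Ω α x) 0 p
      rw [zero_smul, zero_mul] at h0
      exact h0
    refine Eq.trans ?_ h.symm
    rw [LinearMap.zero_apply, LinearMap.zero_apply, map_zero]
    rfl
  act_d := by simp
  J_skew_left _ _ _ := by
    ext x; exact alt3_12 (E := E) (Ω.form.1 x) _ _ _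
  J_skew_right _ _ _ := by
    ext x; exact alt3_01 (E := E) (Ω.form.1 x) _ _ _
  d_J α β γ := hamBracket_jacobi Ω α β γ
  J_d α β f := by
    ext x
    have h : Ω.form.1 x ![hamVec Ω (diffHam Ω f) x, hamVec Ω β x, hamVec Ω α x] = 0 := by
      rw [hamVec_diffHam]
      have h0 := smul3_1 (E := E) (Ω.form.1 x) 0 0 (hamVec Ω β x) (hamVec Ω α x)
      rw [zero_smul, zero_mul] at h0
      exact h0
    refine Eq.trans ?_ h.symm
    simp
  J_coherence α β γ δ := by
    have hm : ∀ ε : HamForm Ω, hamVec Ω ε ∈ HamVField Ω := fun ε => ⟨ε.1, hamVec_spec Ω ε⟩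
    ext x
    have h := ham_cocycle Ω (hm α) (hm β) (hm γ) (hm δ) x
    simp only [LinearMap.zero_apply, neg_zero, zero_add, add_zero]
    simp only [← hamVec_hamBracket] at h
    exact h

end Observables

end Plectic

end

open Plectic

/-!
The morphism `L_∞(M, Ω) → L_∞(𝔛_Ham(M), x)` is evaluation at `x` on functions and `α ↦ v_α` on
Hamiltonian 1-forms. Since `v_[α,β] = [v_α, v_β]`, and since the Jacobiator of the target is the
Jacobiator of the source evaluated at `x`, it is strict (`obsToHam`).

On homology, degree 1 is the statement that a function with zero differential on a connected
manifold is constant (`eq_of_isPrimitiveAt_zero`). In degree 0 the map is surjective by the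
definition of a Hamiltonian vector field, and `v_α = 0` holds exactly when `α` is closed, so that
injectivity is the vanishing of the first de Rham cohomology of a simply connected manifold
(`exists_diff_eq_of_extD_eq_zero`).

For the latter, the Poincaré lemma in balls of the charts gives local primitives `f i` of a closed
1-form (`exists_local_primitive`), whose differences are locally constant. They are glued by
covering space theory (`exists_primitive_of_locally_constant_sub`): translations by them are the
transition functions of a fibre bundle over `M` whose fibre is `ℝ` with the discrete topology.
This bundle is a covering, so over a simply connected base it has a continuous section, and the
section is a function that differs from every `f i` by a locally constant function.

The central extension `b𝔲(1) → L_∞(𝔛_Ham(M), x) → 𝔛_Ham(M)` consists of the inclusion of the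
degree-1 part and the projection onto the degree-0 part.
-/

/-! ### Gluing functions along a cover of a simply connected space -/

/-- Functions `f i` on the members `U i` of an open cover of a simply connected space that have
locally constant differences on overlaps come, up to locally constant functions, from one global
function. -/
theorem exists_primitive_of_locally_constant_sub {X A : Type*} [TopologicalSpace X]
    [SimplyConnectedSpace X] [LocallyPathConnectedSpace X] [AddCommGroup A]
    (U : X → Set X) (hU : ∀ c, IsOpen (U c)) (hmem : ∀ c, c ∈ U c) (f : X → X → A)
    (hf : ∀ i j, ∀ x ∈ U i ∩ U j, ∀ᶠ y in 𝓝 x, f i y - f j y = f i x - f j x) :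
    ∃ F : X → A, ∀ i, ∀ x ∈ U i, ∀ᶠ y in 𝓝 x, F y - f i y = F x - f i x := by
  -- With the discrete topology on `A`, continuous maps to `A` are the locally constant ones.
  let _ : TopologicalSpace A := ⊥
  have : DiscreteTopology A := ⟨rfl⟩
  -- An element `v` of the fibre over `x` in the `i`-th trivialization stands for `F x - f i x`.
  let Z : FiberBundleCore X X A :=
    { baseSet := U
      isOpen_baseSet := hU
      indexAt := id
      mem_baseSet_at := hmem
      coordChange := fun i j x v => v + (f i x - f j x)
      coordChange_self := fun i x _ v => by simp
      continuousOn_coordChange := by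
        rintro i j ⟨x, v⟩ ⟨hx, -⟩
        refine ContinuousAt.continuousWithinAt ?_
        refine continuousAt_snd.add ?_
        refine ContinuousAt.comp (f := Prod.fst) (g := fun y => f i y - f j y) ?_ continuousAt_fst
        exact continuousAt_const.congr (EventuallyEq.symm (hf i j x hx))
      coordChange_comp := fun i j k x _ v => by abel }
  obtain ⟨x₀⟩ : Nonempty X := inferInstance
  have cov : IsCoveringMap (Bundle.TotalSpace.proj : Z.TotalSpace → X) :=
    FiberBundle.isCoveringMap (F := A)
  obtain ⟨s, ⟨-, hs⟩, -⟩ := cov.existsUnique_continuousMap_lifts (ContinuousMap.id X) x₀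
    (⟨x₀, (0 : A)⟩ : Z.TotalSpace) rfl
  have hs' : ∀ y, (s y).1 = y := fun y => congrFun hs y
  -- The fibre over `y` is read in the trivialization with index `y`, so `s y` is `F y - f y y`.
  let val : Z.TotalSpace → A := fun e => e.2
  refine ⟨fun y => val (s y) + f y y, fun i x hx => ?_⟩
  have hc : ContinuousAt (fun y => (Z.localTriv i (s y)).2) x := by
    have h1 : ContinuousAt (Z.localTriv i) (s x) :=
      (Z.localTriv i).continuousAt (by
        rw [Z.mem_localTriv_source]
        change (s x).1 ∈ U i
        rwa [hs' x])
    exact continuousAt_snd.comp (h1.comp s.continuous.continuousAt)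
  have hv : ∀ y, (Z.localTriv i (s y)).2 = val (s y) + f y y - f i y := by
    intro y
    change val (s y) + (f (s y).1 (s y).1 - f i (s y).1) = _
    rw [hs' y, add_sub_assoc]
  simp only [hv] at hc
  exact hc.eventually (isOpen_discrete {val (s x) + f x x - f i x} |>.mem_nhds rfl)

/-! ### Primitives of closed 1-forms -/

section
variable {E : Type*} [NormedAddCommGroup E] [NormedSpace ℝ E]
  {M : Type*} [TopologicalSpace M] [ChartedSpace E M]

/-- Alternating forms in one variable are linear functionals. -/
noncomputable def altOneEquiv (E : Type*) [NormedAddCommGroup E] [NormedSpace ℝ E] :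
    (E [⋀^Fin 1]→L[ℝ] ℝ) ≃ₗᵢ[ℝ] (E →L[ℝ] ℝ) :=
  (ContinuousAlternatingMap.ofSubsingletonLIE (𝕜 := ℝ) (E := E) (F := ℝ) (0 : Fin 1)).symm

theorem altOneEquiv_apply (B : E [⋀^Fin 1]→L[ℝ] ℝ) (p : E) : altOneEquiv E B p = B ![p] := by
  change B _ = _
  congr 1
  ext i; fin_cases i; rfl

theorem altOneEquiv_comp {E' : Type*} [NormedAddCommGroup E'] [NormedSpace ℝ E']
    (B : E' [⋀^Fin 1]→L[ℝ] ℝ) (A : E →L[ℝ] E') :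
    altOneEquiv E (B.compContinuousLinearMap A) = (altOneEquiv E' B).comp A := by
  ext p
  rw [altOneEquiv_apply, ContinuousLinearMap.comp_apply, altOneEquiv_apply,
    ContinuousAlternatingMap.compContinuousLinearMap_apply]
  congr 1
  ext i; fin_cases i; rfl

/-- `f` is a primitive of the 1-form `α` at the point `x`. -/
def IsPrimitiveAt (f : M → ℝ) (α : RawForm E M 1) (x : M) : Prop :=
  HasMFDerivAt 𝓘(ℝ, E) 𝓘(ℝ, ℝ) f x (altOneEquiv E (α x))

theorem IsPrimitiveAt.sub {f g : M → ℝ} {α β : RawForm E M 1} {x : M}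
    (hf : IsPrimitiveAt f α x) (hg : IsPrimitiveAt g β x) :
    IsPrimitiveAt (fun y => f y - g y) (α - β) x :=
  (HasMFDerivAt.sub hf hg).congr_mfderiv (map_sub (altOneEquiv E) (α x) (β x)).symm

variable [IsManifold 𝓘(ℝ, E) ∞ M]

/-- In a chart, a primitive of `α` is a primitive of the local representative of `α`. -/
theorem IsPrimitiveAt.hasFDerivAt_chart {f : M → ℝ} {α : RawForm E M 1} {c : M} {u : E}
    (hu : u ∈ (extChartAt 𝓘(ℝ, E) c).target)
    (h : IsPrimitiveAt f α ((extChartAt 𝓘(ℝ, E) c).symm u)) :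
    HasFDerivAt (fun y => f ((extChartAt 𝓘(ℝ, E) c).symm y)) (altOneEquiv E (chartRep α c u)) u := by
  have h1 := HasMFDerivAt.comp u h
    ((symm_contMDiffAt hu).mdifferentiableAt (by simp)).hasMFDerivAt
  refine HasMFDerivAt.hasFDerivAt (h1.congr_mfderiv ?_)
  exact (altOneEquiv_comp (E := E) (E' := E) _ _).symm

theorem isPrimitiveAt_of_chart {g : E → ℝ} {α : RawForm E M 1} {c x : M}
    (hx : x ∈ (extChartAt 𝓘(ℝ, E) c).source)
    (h : HasFDerivAt g (altOneEquiv E (chartRep α c (extChartAt 𝓘(ℝ, E) c x)))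
      (extChartAt 𝓘(ℝ, E) c x)) :
    IsPrimitiveAt (fun y => g (extChartAt 𝓘(ℝ, E) c y)) α x := by
  have h1 := HasMFDerivAt.comp x h.hasMFDerivAt
    ((chart_contMDiffAt hx).mdifferentiableAt (by simp)).hasMFDerivAt
  refine h1.congr_mfderiv ?_
  rw [eq_chartRep_comp α hx]
  exact (altOneEquiv_comp (E := E) (E' := E) _ _).symm

/-- A function with vanishing differential near `x` is constant near `x`. -/
theorem eventually_eq_of_isPrimitiveAt_zero {f : M → ℝ} {x : M}
    (h : ∀ᶠ y in 𝓝 x, IsPrimitiveAt f (0 : RawForm E M 1) y) : ∀ᶠ y in 𝓝 x, f y = f x := by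
  have hx := mem_extChartAt_target (I := 𝓘(ℝ, E)) x
  have hxs := mem_extChartAt_source (I := 𝓘(ℝ, E)) x
  have h1 : ∀ᶠ u in 𝓝 (extChartAt 𝓘(ℝ, E) x x),
      IsPrimitiveAt f (0 : RawForm E M 1) ((extChartAt 𝓘(ℝ, E) x).symm u) := by
    refine (symm_contMDiffAt hx).continuousAt.eventually ?_
    rwa [(extChartAt 𝓘(ℝ, E) x).left_inv hxs]
  obtain ⟨r, hr, hball⟩ := Metric.eventually_nhds_iff_ball.mp
    (h1.and ((isOpen_target x).mem_nhds hx))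
  have hconst : ∀ u ∈ Metric.ball (extChartAt 𝓘(ℝ, E) x x) r,
      f ((extChartAt 𝓘(ℝ, E) x).symm u) = f x := by
    intro u hu
    have hd : ∀ z ∈ Metric.ball (extChartAt 𝓘(ℝ, E) x x) r,
        HasFDerivAt (fun y => f ((extChartAt 𝓘(ℝ, E) x).symm y)) (0 : E →L[ℝ] ℝ) z := by
      intro z hz
      convert (hball z hz).1.hasFDerivAt_chart (hball z hz).2
      exact (map_zero (altOneEquiv E)).symm
    have := (convex_ball (extChartAt 𝓘(ℝ, E) x x) r).is_const_of_fderivWithin_eq_zero (𝕜 := ℝ)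
      (fun z hz => (hd z hz).differentiableAt.differentiableWithinAt)
      (fun z hz => by
        rw [fderivWithin_of_isOpen Metric.isOpen_ball hz, (hd z hz).fderiv])
      hu (Metric.mem_ball_self hr)
    simpa only [(extChartAt 𝓘(ℝ, E) x).left_inv hxs] using this
  filter_upwards [(chart_contMDiffAt hxs).continuousAt.preimage_mem_nhds
      (Metric.ball_mem_nhds _ hr), (isOpen_extChartAt_source (I := 𝓘(ℝ, E)) x).mem_nhds hxs]
    with y hy hys
  have := hconst _ hy
  rwa [(extChartAt 𝓘(ℝ, E) x).left_inv hys] at this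

theorem eq_of_isPrimitiveAt_zero [PreconnectedSpace M] {f : M → ℝ}
    (h : ∀ x, IsPrimitiveAt f (0 : RawForm E M 1) x) (x y : M) : f x = f y :=
  ((IsLocallyConstant.iff_eventually_eq f).mpr fun _ =>
    eventually_eq_of_isPrimitiveAt_zero (Eventually.of_forall h)).apply_eq_of_preconnectedSpace x y

/-- The Poincaré lemma: a closed 1-form has a primitive near every point `c`, on the preimage of a
ball under the chart around `c`. -/
theorem exists_local_primitive {α : RawForm E M 1} (hα : α ∈ DiffForm E M 1) (hd : extD α = 0)
    (c : M) : ∃ U : Set M, IsOpen U ∧ c ∈ U ∧ ∃ f : M → ℝ, ∀ x ∈ U, IsPrimitiveAt f α x := by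
  have hc := mem_extChartAt_target (I := 𝓘(ℝ, E)) c
  obtain ⟨r, hr, hball⟩ := Metric.isOpen_iff.mp (isOpen_target c) _ hc
  have hdiff : ∀ u ∈ Metric.ball (extChartAt 𝓘(ℝ, E) c c) r,
      DifferentiableAt ℝ (chartRep α c) u := fun u hu =>
    (chartRep_contDiffAt hα (hball hu)).differentiableAt (by simp)
  have hfd : ∀ u ∈ Metric.ball (extChartAt 𝓘(ℝ, E) c c) r,
      HasFDerivAt (fun u => altOneEquiv E (chartRep α c u))
        (((altOneEquiv E).toContinuousLinearEquiv : (E [⋀^Fin 1]→L[ℝ] ℝ) →L[ℝ] E →L[ℝ] ℝ).comp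
          (fderiv ℝ (chartRep α c) u)) u :=
    fun u hu => (altOneEquiv E).toContinuousLinearEquiv.hasFDerivAt.comp u (hdiff u hu).hasFDerivAt
  have hdiff' : DifferentiableOn ℝ (fun u => altOneEquiv E (chartRep α c u))
      (Metric.ball (extChartAt 𝓘(ℝ, E) c c) r) :=
    fun u hu => (hfd u hu).differentiableAt.differentiableWithinAt
  obtain ⟨g, hg⟩ := (convex_ball (extChartAt 𝓘(ℝ, E) c c) r
    ).exists_forall_hasFDerivAt_of_fderiv_symmetric Metric.isOpen_ball
    hdiff' (by
      intro u hu p q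
      rw [(hfd u hu).fderiv]
      -- Closedness in the chart is the symmetry of the derivative of the representative.
      have h0 : extDeriv (chartRep α c) u = 0 := by
        rw [← chartRep_extD hα (hball hu), hd]; rfl
      have h1 := extDeriv_one (B := chartRep α c) (u := u) p q
      rw [h0] at h1
      change altOneEquiv E (fderiv ℝ (chartRep α c) u p) q =
        altOneEquiv E (fderiv ℝ (chartRep α c) u q) p
      rw [altOneEquiv_apply, altOneEquiv_apply]
      exact sub_eq_zero.mp h1.symm)
  refine ⟨(extChartAt 𝓘(ℝ, E) c).source ∩
      extChartAt 𝓘(ℝ, E) c ⁻¹' Metric.ball (extChartAt 𝓘(ℝ, E) c c) r,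
    (continuousOn_extChartAt c).isOpen_inter_preimage (isOpen_extChartAt_source c)
      Metric.isOpen_ball, ⟨mem_extChartAt_source c, Metric.mem_ball_self hr⟩,
    fun y => g (extChartAt 𝓘(ℝ, E) c y), fun x hx => ?_⟩
  exact isPrimitiveAt_of_chart hx.1 (hg _ hx.2)

/-- In every chart the derivative of a primitive is the local representative of the form, hence
smooth. -/
theorem contMDiff_of_isPrimitiveAt {α : RawForm E M 1} (hα : α ∈ DiffForm E M 1) {F : M → ℝ}
    (h : ∀ x, IsPrimitiveAt F α x) : ContMDiff 𝓘(ℝ, E) 𝓘(ℝ, ℝ) ∞ F := by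
  refine contMDiff_of_charts fun c u hu => ?_
  have hd : ∀ z ∈ (extChartAt 𝓘(ℝ, E) c).target, HasFDerivAt
      (fun y => F ((extChartAt 𝓘(ℝ, E) c).symm y)) (altOneEquiv E (chartRep α c z)) z :=
    fun z hz => (h _).hasFDerivAt_chart hz
  refine ContDiffOn.contDiffAt ?_ ((isOpen_target c).mem_nhds hu)
  rw [contDiffOn_infty_iff_fderiv_of_isOpen (isOpen_target c)]
  refine ⟨fun z hz => (hd z hz).differentiableAt.differentiableWithinAt, ?_⟩
  refine ((altOneEquiv E).contDiff.comp_contDiffOn (hα c)).congr fun z hz => ?_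
  exact (hd z hz).fderiv

/-- On a simply connected manifold, every closed 1-form is exact. -/
theorem exists_diff_eq_of_extD_eq_zero [SimplyConnectedSpace M] (α : DiffForm E M 1)
    (hd : extD α.1 = 0) : ∃ F : SmoothFun E M, diff F = α := by
  have : LocallyPathConnectedSpace M := ChartedSpace.locallyPathConnectedSpace E M
  choose U hU hmem f hf using exists_local_primitive α.2 hd
  obtain ⟨F, hF⟩ := exists_primitive_of_locally_constant_sub U hU hmem f fun i j x hx =>
    eventually_eq_of_isPrimitiveAt_zero (f := fun y => f i y - f j y) <| by
      filter_upwards [(hU i).mem_nhds hx.1, (hU j).mem_nhds hx.2] with y hi hj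
      have := (hf i y hi).sub (hf j y hj)
      rwa [sub_self] at this
  have hprim : ∀ x, IsPrimitiveAt F α.1 x := by
    intro x
    refine (HasMFDerivAt.add (hf x x (hmem x)) (hasMFDerivAt_const (F x - f x x) x)
      ).congr_of_eventuallyEq ?_ |>.congr_mfderiv (add_zero _)
    filter_upwards [hF x x (hmem x)] with y hy
    exact eq_add_of_sub_eq' hy
  refine ⟨⟨F, contMDiff_of_isPrimitiveAt α.2 hprim⟩, ?_⟩
  apply Subtype.ext
  funext x
  apply (altOneEquiv E).injective
  change altOneEquiv E (ContinuousAlternatingMap.ofSubsingleton ℝ E ℝ 0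
    (mfderiv 𝓘(ℝ, E) 𝓘(ℝ, ℝ) F x)) = _
  rw [(hprim x).mfderiv]
  exact (altOneEquiv E).apply_symm_apply _

end

/-! ### The Lie 2-algebras of a 2-plectic manifold -/

/-- A chain map that preserves the brackets and the Jacobiators strictly is a morphism of Lie
2-algebras, with zero homotopy. -/
def Plectic.Lie2Hom.ofStrict {L₁ L₀ L₁' L₀' : Type*}
    [AddCommGroup L₁] [Module ℝ L₁] [AddCommGroup L₀] [Module ℝ L₀]
    [AddCommGroup L₁'] [Module ℝ L₁'] [AddCommGroup L₀'] [Module ℝ L₀']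
    {L : Lie2Algebra L₁ L₀} {L' : Lie2Algebra L₁' L₀'} (φ₁ : L₁ →ₗ[ℝ] L₁') (φ₀ : L₀ →ₗ[ℝ] L₀')
    (comm : ∀ h, φ₀ (L.d h) = L'.d (φ₁ h))
    (map_br : ∀ x y, φ₀ (L.br x y) = L'.br (φ₀ x) (φ₀ y))
    (map_act : ∀ x h, φ₁ (L.act x h) = L'.act (φ₀ x) (φ₁ h))
    (map_J : ∀ x y z, φ₁ (L.J x y z) = L'.J (φ₀ x) (φ₀ y) (φ₀ z)) : Lie2Hom L L' where
  φ₁ := φ₁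
  φ₀ := φ₀
  Φ := 0
  comm := comm
  Φ_skew := by simp
  d_Φ x y := by simp [map_br]
  Φ_d x h := by simp [map_act]
  coherence x y z := by simp [map_J]

section Observables
variable {E : Type*} [NormedAddCommGroup E] [NormedSpace ℝ E] [FiniteDimensional ℝ E]
  {M : Type*} [TopologicalSpace M] [ChartedSpace E M] [IsManifold 𝓘(ℝ, E) ∞ M]
  (Ω : TwoPlecticForm E M)

/-- The linear map `α ↦ v_α` from Hamiltonian 1-forms to Hamiltonian vector fields. -/
noncomputable def hamVecLinear : HamForm Ω →ₗ[ℝ] HamVField Ω where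
  toFun α := ⟨hamVec Ω α, α.1, hamVec_spec Ω α⟩
  map_add' α β := Subtype.ext (hamVec_add α β)
  map_smul' r α := Subtype.ext (hamVec_smul r α)

theorem hamVecLinear_surjective : Function.Surjective (hamVecLinear Ω) := by
  rintro ⟨v, α, h⟩
  exact ⟨⟨α, v, h⟩, Subtype.ext (hamVec_eq (α := ⟨α, v, h⟩) h)⟩

theorem hamVecLinear_diffHam (f : SmoothFun E M) : hamVecLinear Ω (diffHam Ω f) = 0 :=
  Subtype.ext (hamVec_diffHam Ω f)

/-- The first de Rham cohomology of a simply connected manifold vanishes, so the Hamiltonian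
1-forms with zero Hamiltonian vector field, which are the closed ones, are differentials. -/
theorem ker_hamVecLinear [SimplyConnectedSpace M] :
    LinearMap.ker (hamVecLinear Ω) = LinearMap.range (diffHam Ω) := by
  ext α
  constructor
  · intro h
    have hv : hamVec Ω α = 0 := congrArg Subtype.val (LinearMap.mem_ker.mp h)
    have hd : extD α.1.1 = 0 := by
      have := hamVec_spec Ω α
      rw [hv, IsHamiltonianPair, contract_zero] at this
      exact this.trans neg_zero
    obtain ⟨F, hF⟩ := exists_diff_eq_of_extD_eq_zero α.1 hd
    exact ⟨F, Subtype.ext hF⟩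
  · rintro ⟨f, rfl⟩
    exact hamVecLinear_diffHam Ω f

/-- Evaluation of smooth functions at a point. -/
noncomputable def evalLinear (x : M) : SmoothFun E M →ₗ[ℝ] ℝ where
  toFun f := f x
  map_add' _ _ := rfl
  map_smul' _ _ := rfl

theorem isPrimitiveAt_zero_of_diffHam_eq_zero {f : SmoothFun E M} (h : diffHam Ω f = 0) (x : M) :
    IsPrimitiveAt f (0 : RawForm E M 1) x := by
  have h0 : rawDiff f = 0 := congrArg (fun α : HamForm Ω => α.1.1) h
  refine (((f.contMDiff x).mdifferentiableAt (by simp)).hasMFDerivAt).congr_mfderiv ?_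
  exact (altOneEquiv E).symm_apply_eq.mp (congrFun h0 x)

/-- The morphism `L_∞(M, Ω) → L_∞(𝔛_Ham(M), x)`: evaluation at `x` on functions and `α ↦ v_α` on
1-forms. It preserves the brackets and Jacobiators strictly, so its homotopy is zero. -/
noncomputable def obsToHam (x : M) : Lie2Hom (lieTwoObs Ω) (lieTwoHam Ω x) :=
  Lie2Hom.ofStrict (evalLinear x) (hamVecLinear Ω) (hamVecLinear_diffHam Ω)
    (fun α β => Subtype.ext (hamVec_hamBracket Ω α β)) (fun _ _ => rfl) (fun _ _ _ => rfl)

theorem obsToHam_isQuasiIso [SimplyConnectedSpace M] (x : M) : (obsToHam Ω x).IsQuasiIso := by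
  refine ⟨⟨?_, ?_⟩, ⟨?_, ?_⟩⟩
  · rw [injective_iff_map_eq_zero]
    rintro ⟨f, hf⟩ h
    apply Subtype.ext
    have hfx : f x = 0 := congrArg Subtype.val h
    ext y
    exact (eq_of_isPrimitiveAt_zero (isPrimitiveAt_zero_of_diffHam_eq_zero Ω hf) y x).trans hfx
  · rintro ⟨r, _⟩
    have hr : diffHam Ω (ContMDiffMap.const r) = 0 := by
      refine hamForm_ext Ω fun y p => ?_
      rw [diffHam_apply]
      exact congrArg (fun L : E →L[ℝ] ℝ => L p) (mfderiv_const (c := r))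
    exact ⟨⟨ContMDiffMap.const r, hr⟩, rfl⟩
  · rw [injective_iff_map_eq_zero]
    intro a
    induction a using Submodule.Quotient.induction_on with
    | H α =>
      intro h
      have h' : hamVecLinear Ω α ∈ LinearMap.range (lieTwoHam Ω x).d :=
        (Submodule.Quotient.mk_eq_zero _).mp h
      obtain ⟨r, hr⟩ := h'
      refine (Submodule.Quotient.mk_eq_zero _).mpr ?_
      change α ∈ LinearMap.range (diffHam Ω)
      rw [← ker_hamVecLinear]
      exact hr.symm
  · intro b
    induction b using Submodule.Quotient.induction_on with
    | H v =>
      obtain ⟨α, rfl⟩ := hamVecLinear_surjective Ω v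
      exact ⟨Submodule.Quotient.mk α, rfl⟩

/-- The inclusion `b𝔲(1) → L_∞(𝔛_Ham(M), x)` of the degree-1 part. -/
noncomputable def bu1ToHam (x : M) : Lie2Hom bu1 (lieTwoHam Ω x) :=
  Lie2Hom.ofStrict LinearMap.id 0 (fun _ => rfl) (fun _ _ => by simp) (fun _ _ => rfl)
    (fun _ _ _ => by simp [bu1, abelianLie2])

/-- The projection of `L_∞(𝔛_Ham(M), x)` onto its degree-0 part. -/
noncomputable def hamToTrivial (x : M) : Lie2Hom (lieTwoHam Ω x) (trivialLie2 (HamVField Ω)) :=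
  Lie2Hom.ofStrict 0 LinearMap.id (fun _ => rfl) (fun _ _ => rfl) (fun _ _ => rfl)
    (fun _ _ _ => rfl)

theorem lieTwoHam_isStrictCentralExtension (x : M) :
    IsStrictCentralExtension bu1 (lieTwoHam Ω x) (trivialLie2 (HamVField Ω)) := by
  refine ⟨bu1ToHam Ω x, hamToTrivial Ω x,
    ⟨Function.injective_id, fun r => ⟨fun _ => ⟨r, rfl⟩, fun _ => rfl⟩, fun _ => ⟨0, rfl⟩⟩,
    ⟨fun _ _ _ => rfl, fun v => ⟨fun h => ⟨0, h.symm⟩, ?_⟩, Function.surjective_id⟩,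
    fun _ v => ?_, fun _ _ => rfl, fun _ _ => rfl⟩
  · rintro ⟨_, rfl⟩
    rfl
  · change (lieTwoHam Ω x).br 0 v = 0
    simp

end Observables

theorem mainTheorem3 {E : Type*} [NormedAddCommGroup E] [NormedSpace ℝ E] [FiniteDimensional ℝ E]
    {M : Type*} [TopologicalSpace M] [T2Space M] [SecondCountableTopology M]
    [ChartedSpace E M] [IsManifold 𝓘(ℝ, E) ∞ M] [SimplyConnectedSpace M]
    (Ω : TwoPlecticForm E M) (x : M) :
    (∃ f : Lie2Hom (lieTwoObs Ω) (lieTwoHam Ω x), f.IsQuasiIso) ∧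
      IsStrictCentralExtension bu1 (lieTwoHam Ω x) (trivialLie2 (HamVField Ω)) :=
  ⟨⟨obsToHam Ω x, obsToHam_isQuasiIso Ω x⟩, lieTwoHam_isStrictCentralExtension Ω x⟩
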